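/- Let $h:\mathbb R^m\to\mathbb R\cup\{+\infty\}$ be proper, convex and piecewise linear-quadratic, given by a Rockafellar–Wets representation: $\operatorname{dom}h=\bigcup_k C_k$ is a finite union of polyhedra $C_k=\{p:\langle\omega_{kj}a_j,p\rangle\le\omega_{kj}\alpha_j\ \forall j\}$ cut out by one common finite family of hyperplanes $(a_j,\alpha_j)$, $a_j\ne0$, with signs $\omega_{kj}\in\{\pm1\}$, the interiors of the $C_k$ are nonempty and pairwise disjoint, and $h(p)=\frac12\langle p,Q_kp\rangle+\langle b_k,p\rangle+\beta_k$ on $C_k$ with $Q_k$ symmetric. Let $c:\mathbb R^n\to\mathbb R^m$ be $C^3$, $\bar x\in\mathbb R^n$, $\bar y\in\mathbb R^m$, $\bar c=c(\bar x)\in\operatorname{dom}h$, $\mathcal K(\bar c)=\{k:\bar c\in C_k\}$ with $|\mathcal K(\bar c)|\ge2$, and $I=\{j:\langle a_j,\bar c\rangle=\alpha_j\}$. Fix $k_0\in\mathcal K(\bar c)$, let $A$ be the matrix with columns $\omega_{k_0j}a_j$ ($j\in I$), and for $k\in\mathcal K(\bar c)$ let $P_k$ be the diagonal $\pm1$ matrix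 such that $AP_k$ has columns $\omega_{kj}a_j$. The active manifold is $$\mathcal M_{\bar c}=\{p:\langle a_j,p\rangle=\alpha_j\ (j\in I),\ \langle\omega_{kj}a_j,p\rangle<\omega_{kj}\alpha_j\ (k\in\mathcal K(\bar c),\ j\notin I)\},$$ the relatively open face of $\bigcap_{k\in\mathcal K(\bar c)}C_k$ containing $\bar c$; it equals $\operatorname{ri}\bigcap_{k\in\mathcal K(\bar c)}C_k$ whenever $\bar c$ lies in the latter set. Assume: (i) nondegeneracy: $\operatorname{Null}A=\{0\}$; (ii) strict criticality: $\operatorname{Null}\nabla c(\bar x)^\top\cap\operatorname{ri}\partial h(\bar c)=\{\bar y\}$, and there are $\bar\mu=(\bar\mu_k)_{k\in\mathcal K(\bar c)}$ with all components strictly positive such that $\bar y=Q_k\bar c+b_k+AP_k\bar\mu_k$ for all $k\in\mathcal K(\bar c)$; (iii) second-order sufficiency: $h''(\bar c;\nabla c(\bar x)d)+\langle d,\nabla^2(\bar yc)(\bar x)d\rangle>0$ for all $d\ne0$ with $A^\top\nabla c(\bar x)d=0$, where $(yc)(x)=\langle y,c(x)\rangle$ and $h''$ is the one-sided second directional derivative.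 Write $\hat c^{\,i}=c(x^{i-1})+\nabla c(x^{i-1})(x^i-x^{i-1})$ and $H_{i-1}=\nabla^2(y^{i-1}c)(x^{i-1})$, and let $\mu(p,y)_k=P_k(A^\top A)^{-1}A^\top(y-Q_kp-b_k)$. A Newton sequence is a sequence $(x^i,y^i,\mu^i)_{i\ge0}$ such that for every $i\ge1$ the optimality conditions of the subproblem $$(P_{i-1})\qquad \min_x\ h\big(c(x^{i-1})+\nabla c(x^{i-1})(x-x^{i-1})\big)+\tfrac12(x-x^{i-1})^\top H_{i-1}(x-x^{i-1})$$ hold, i.e. $H_{i-1}(x^i-x^{i-1})+\nabla c(x^{i-1})^\top y^i=0$ and $y^i\in\partial h(\hat c^{\,i})$, with multipliers $\mu^i\ge0$, $y^i=Q_k\hat c^{\,i}+b_k+AP_k\mu^i_k$ for all $k\in\mathcal K(\bar c)$. Then there are a neighborhood $\mathcal N$ of $(\bar x,\bar y,\bar\mu)$ and a constant $\gamma>0$ such that for all $(x,y,\mu)\in\mathcal N$ one has $\operatorname{Null}\nabla c(x)^\top\cap\operatorname{Ran}A=\{0\}$ and $d^\top\nabla c(x)^\top Q_k\nabla c(x)d+d^\top\nabla^2(yc)(x)d>0$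 for all $k\in\mathcal K(\bar c)$ and all $d\neq0$ with $A^\top\nabla c(x)d=0$, and such that from every $(x^0,y^0,\mu^0)\in\mathcal N$ there starts a Newton sequence contained in $\mathcal N$ with, for all $i\ge1$: (a) $\hat c^{\,i}\in\mathcal M_{\bar c}$ (and $\hat c^{\,i}\in\operatorname{ri}\bigcap_{k\in\mathcal K(\bar c)}C_k$ if $\bar c\in\operatorname{ri}\bigcap_{k\in\mathcal K(\bar c)}C_k$); (b) $\mu(\hat c^{\,i},y^i)_k=\mu^i_k$ has strictly positive components for all $k\in\mathcal K(\bar c)$; (c) $y^i\in\operatorname{ri}\partial h(\hat c^{\,i})$; (d) $H_{i-1}(x^i-x^{i-1})+\nabla c(x^{i-1})^\top y^i=0$; (e) $x^i-x^{i-1}$ is a strong local minimizer of the model function $\phi(d)=h(c(x^{i-1})+\nabla c(x^{i-1})d)+\frac12d^\top H_{i-1}d$: $\phi$ is finite there and, for some $\gamma'>0$, $\phi(e)\ge\phi(x^i-x^{i-1})+\gamma'\|e-(x^i-x^{i-1})\|^2$ for all $e$ near $x^i-x^{i-1}$. Moreover $(x^i,y^i)\to(\bar x,\bar y)$ with $\|(x^{i+1}-\bar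 x,y^{i+1}-\bar y)\|\le\gamma\|(x^i-\bar x,y^i-\bar y)\|^2$ for all $i\ge0$, where $\|(u,v)\|=\max(\|u\|,\|v\|)$. The sequence is the only Newton sequence from $(x^0,y^0,\mu^0)$ satisfying (a) for all $i\ge1$, and also the only one that stays in $\mathcal N$. -/

import Mathlib

open Set Filter Topology

namespace PLQComposite

noncomputable section

/-- `ℝⁿ` with the Euclidean norm and the standard inner product. -/
abbrev Vec (n : ℕ) := EuclideanSpace ℝ (Fin n)

/-! ### Extended-real-valued functions -/

/-- `dom h`. -/
def effDomain {m : ℕ} (h : Vec m → EReal) : Set (Vec m) := {p | h p < ⊤}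

/-- `h` is proper, and convex in the sense that its epigraph is convex. -/
structure IsProperConvex {m : ℕ} (h : Vec m → EReal) : Prop where
  nonempty_domain : (effDomain h).Nonempty
  ne_bot : ∀ p, h p ≠ ⊥
  convex_epigraph : Convex ℝ {q : Vec m × ℝ | h q.1 ≤ (q.2 : EReal)}

/-- The subdifferential `∂h(p)` of convex analysis; it is empty outside `dom h`. -/
def subdifferential {m : ℕ} (h : Vec m → EReal) (p : Vec m) : Set (Vec m) :=
  {y | p ∈ effDomain h ∧ ∀ q, h p + ((inner ℝ y (q - p) : ℝ) : EReal) ≤ h q}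

/-- The one-sided directional derivative `h'(p; w)` exists, is finite and equals `L`
(used at points where `h` is finite). -/
def HasDirDeriv {m : ℕ} (h : Vec m → EReal) (p w : Vec m) (L : ℝ) : Prop :=
  Tendsto (fun t : ℝ => (h (p + t • w) - h p) / (t : EReal)) (𝓝[>] 0) (𝓝 (L : EReal))

/-- `h'(p; w)` exists and is finite, and the one-sided second directional derivative
`h''(p; w) = lim_{t ↘ 0} (h (p + t w) - h p - t h'(p; w)) / (t² / 2)` exists and equals `L`. -/
def HasSecondDirDeriv {m : ℕ} (h : Vec m → EReal) (p w : Vec m) (L : EReal) : Prop :=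
  ∃ D : ℝ, HasDirDeriv h p w D ∧
    Tendsto (fun t : ℝ => (h (p + t • w) - h p - ((t * D : ℝ) : EReal)) / ((t ^ 2 / 2 : ℝ) : EReal))
      (𝓝[>] 0) (𝓝 L)

/-- `d` is a strong local minimizer of `φ`: `φ` is finite at `d` and grows at least quadratically
around `d`. -/
def IsStrongLocalMin {n : ℕ} (φ : Vec n → EReal) (d : Vec n) : Prop :=
  φ d ≠ ⊤ ∧ φ d ≠ ⊥ ∧ ∃ U ∈ 𝓝 d, ∃ γ : ℝ, 0 < γ ∧
    ∀ e ∈ U, φ d + ((γ * ‖e - d‖ ^ 2 : ℝ) : EReal) ≤ φ e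

/-! ### Piecewise linear-quadratic functions in Rockafellar-Wets form -/

/-- The polyhedron `{p | ⟨σ j a j, p⟩ ≤ σ j α j for all j}`. -/
def signedPolyhedron {m s : ℕ} (a : Fin s → Vec m) (α : Fin s → ℝ) (σ : Fin s → ℝ) :
    Set (Vec m) :=
  {p | ∀ j, inner ℝ (σ j • a j) p ≤ σ j * α j}

/-- A Rockafellar-Wets representation of the piecewise linear-quadratic function `h`: the domain is
the union of finitely many polyhedra, each cut out by one and the same family of hyperplanes
`⟨a j, p⟩ = α j` with signs `ω k j = ±1`, having nonempty and pairwise disjoint interiors, and on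
the `k`-th polyhedron `h p = ½ ⟨p, Q k p⟩ + ⟨b k, p⟩ + β k` with `Q k` symmetric. -/
structure RWRepresentation {m : ℕ} (h : Vec m → EReal) where
  numPieces : ℕ
  numHyperplanes : ℕ
  a : Fin numHyperplanes → Vec m
  α : Fin numHyperplanes → ℝ
  ω : Fin numPieces → Fin numHyperplanes → ℝ
  Q : Fin numPieces → Matrix (Fin m) (Fin m) ℝ
  b : Fin numPieces → Vec m
  β : Fin numPieces → ℝ
  a_ne_zero : ∀ j, a j ≠ 0
  ω_sign : ∀ k j, ω k j = 1 ∨ ω k j = -1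
  Q_symm : ∀ k, (Q k).IsSymm
  interior_nonempty : ∀ k, (interior (signedPolyhedron a α (ω k))).Nonempty
  interior_disjoint : ∀ k k', k ≠ k' →
    interior (signedPolyhedron a α (ω k)) ∩ interior (signedPolyhedron a α (ω k')) = ∅
  domain_eq : effDomain h = ⋃ k, signedPolyhedron a α (ω k)
  eq_on_piece : ∀ k, ∀ p ∈ signedPolyhedron a α (ω k),
    h p = ((1 / 2 * inner ℝ p (Matrix.toEuclideanLin (Q k) p) + inner ℝ (b k) p + β k : ℝ) : EReal)

namespace RWRepresentation

variable {m : ℕ} {h : Vec m → EReal} (R : RWRepresentation h)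

/-- The polyhedron `C_k`. -/
def piece (k : Fin R.numPieces) : Set (Vec m) := signedPolyhedron R.a R.α (R.ω k)

/-- The indices `𝒦(p)` of the polyhedra that contain `p`. -/
abbrev ActivePiece (p : Vec m) := {k : Fin R.numPieces // p ∈ R.piece k}

/-- The indices of the hyperplanes that contain `p`; since all signs are `±1`, this is the active
index set at `p` of each polyhedron `C_k` with `k ∈ 𝒦(p)`. -/
abbrev ActiveIdx (p : Vec m) := {j : Fin R.numHyperplanes // inner ℝ (R.a j) p = R.α j}

/-- Families `(μ_k)`, `k ∈ 𝒦(p)`, of vectors indexed by the active hyperplanes at `p`. -/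
abbrev Multiplier (p : Vec m) := R.ActivePiece p → EuclideanSpace ℝ (R.ActiveIdx p)

/-- `⋂_{k ∈ 𝒦(p)} C_k`. -/
def activeIntersection (p : Vec m) : Set (Vec m) := ⋂ k : R.ActivePiece p, R.piece k.1

/-- The active manifold at `p`, described by the active hyperplanes: the relatively open face
of `⋂_{k ∈ 𝒦(p)} C_k` that contains `p`. It is `ri ⋂_{k ∈ 𝒦(p)} C_k` when that set contains `p`. -/
def activeManifold (p : Vec m) : Set (Vec m) :=
  {q | (∀ j, inner ℝ (R.a j) p = R.α j → inner ℝ (R.a j) q = R.α j) ∧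
    ∀ k : R.ActivePiece p, ∀ j, inner ℝ (R.a j) p ≠ R.α j →
      inner ℝ (R.ω k.1 j • R.a j) q < R.ω k.1 j * R.α j}

variable {R} {p : Vec m}

/-- The matrix `A`, whose columns are the gradients `ω_{k₀ j} a_j` of the constraints of the
reference polyhedron `C_{k₀}` that are active at `p`. -/
def activeMatrix (k₀ : R.ActivePiece p) : Matrix (Fin m) (R.ActiveIdx p) ℝ :=
  Matrix.of fun i j => R.ω k₀.1 j.1 * R.a j.1 i

/-- The diagonal `±1` matrix `P_k` such that the columns of `A P_k` are the gradients
`ω_{k j} a_j` of the active constraints of `C_k`. -/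
def signMatrix (k₀ k : R.ActivePiece p) : Matrix (R.ActiveIdx p) (R.ActiveIdx p) ℝ :=
  Matrix.diagonal fun j => R.ω k₀.1 j.1 * R.ω k.1 j.1

/-- Nondegeneracy of the active manifold: `Null A = {0}`. -/
def Nondegenerate (k₀ : R.ActivePiece p) : Prop :=
  ∀ v, Matrix.toEuclideanLin (activeMatrix k₀) v = 0 → v = 0

/-- The system `y = Q_k q + b_k + A P_k μ_k` for all `k ∈ 𝒦(p)`. -/
def MultiplierSystem (k₀ : R.ActivePiece p) (q y : Vec m) (μ : R.Multiplier p) : Prop :=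
  ∀ k : R.ActivePiece p, y = Matrix.toEuclideanLin (R.Q k.1) q + R.b k.1 +
    Matrix.toEuclideanLin (activeMatrix k₀ * signMatrix k₀ k) (μ k)

/-- `μ(q, y)_k = P_k (Aᵀ A)⁻¹ Aᵀ (y - (Q_k q + b_k))`. -/
def multiplierOf (k₀ : R.ActivePiece p) (q y : Vec m) : R.Multiplier p := fun k =>
  Matrix.toEuclideanLin
    (signMatrix k₀ k * ((activeMatrix k₀).transpose * activeMatrix k₀)⁻¹ *
      (activeMatrix k₀).transpose)
    (y - (Matrix.toEuclideanLin (R.Q k.1) q + R.b k.1))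

end RWRepresentation

/-! ### The convex-composite problem and its Newton subproblems -/

section Composite

variable {n m : ℕ}

/-- The Hessian `∇²(yc)(x)` of the function `z ↦ ⟨y, c z⟩` at `x`, as a linear operator. -/
def hessYC (c : Vec n → Vec m) (y : Vec m) (x : Vec n) : Vec n →L[ℝ] Vec n :=
  fderiv ℝ (fun x' => gradient (fun z => (inner ℝ y (c z) : ℝ)) x') x

/-- `∇c(x)ᵀ y`. -/
def jacT (c : Vec n → Vec m) (x : Vec n) (y : Vec m) : Vec n :=
  ContinuousLinearMap.adjoint (fderiv ℝ c x) y

/-- The linearized point `c(x̂) + ∇c(x̂)(x - x̂)`. -/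
def linPoint (c : Vec n → Vec m) (xhat x : Vec n) : Vec m :=
  c xhat + fderiv ℝ c xhat (x - xhat)

/-- Strict criticality at `x` for `y`: `Null ∇c(x)ᵀ ∩ ri ∂h(c(x)) = {y}`. -/
def StrictlyCritical (h : Vec m → EReal) (c : Vec n → Vec m) (x : Vec n) (y : Vec m) : Prop :=
  {v | jacT c x v = 0} ∩ intrinsicInterior ℝ (subdifferential h (c x)) = {y}

/-- The model function `φ(d) = h(c(x̂) + ∇c(x̂)d) + ½ ⟨d, ∇²(ŷc)(x̂) d⟩`. -/
def modelFn (h : Vec m → EReal) (c : Vec n → Vec m) (xhat : Vec n) (yhat : Vec m)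
    (d : Vec n) : EReal :=
  h (c xhat + fderiv ℝ c xhat d) + ((1 / 2 * inner ℝ d (hessYC c yhat xhat d) : ℝ) : EReal)

/-- The optimality conditions, at the primal-dual pair `(x, y)`, of the subproblem
`minimize h(c(x̂) + ∇c(x̂)(x - x̂)) + ½ ⟨x - x̂, ∇²(ŷc)(x̂)(x - x̂)⟩` over `x`. -/
structure SubproblemOptimality (h : Vec m → EReal) (c : Vec n → Vec m)
    (xhat : Vec n) (yhat : Vec m) (x : Vec n) (y : Vec m) : Prop where
  stationary : hessYC c yhat xhat (x - xhat) + jacT c xhat y = 0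
  subgradient : y ∈ subdifferential h (linPoint c xhat x)

variable {h : Vec m → EReal} {R : RWRepresentation h} {p : Vec m}

/-- The second-order sufficient conditions at `x` for `y`:
`h''(c(x); ∇c(x)d) + ⟨d, ∇²(yc)(x)d⟩ > 0` for all nonzero `d ∈ Null (Aᵀ ∇c(x))`. -/
def SecondOrderSufficient (c : Vec n → Vec m) (k₀ : R.ActivePiece p) (x : Vec n) (y : Vec m) :
    Prop :=
  ∀ d : Vec n, d ≠ 0 →
    Matrix.toEuclideanLin (RWRepresentation.activeMatrix k₀).transpose (fderiv ℝ c x d) = 0 →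
    ∃ L : EReal, HasSecondDirDeriv h (c x) (fderiv ℝ c x d) L ∧
      0 < L + ((inner ℝ d (hessYC c y x d) : ℝ) : EReal)

/-- The curvature and transversality conditions at `(x, y)`: for all `k ∈ 𝒦(p)`,
`⟨∇c(x)d, Q_k ∇c(x)d⟩ + ⟨d, ∇²(yc)(x)d⟩ > 0` for all nonzero `d ∈ Null (Aᵀ ∇c(x))`, and
`Null ∇c(x)ᵀ ∩ Ran A = {0}`. -/
structure CurvatureTransversality (c : Vec n → Vec m) (k₀ : R.ActivePiece p)
    (x : Vec n) (y : Vec m) : Prop where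
  curvature : ∀ k : R.ActivePiece p, ∀ d : Vec n, d ≠ 0 →
    Matrix.toEuclideanLin (RWRepresentation.activeMatrix k₀).transpose (fderiv ℝ c x d) = 0 →
    (0 : ℝ) < inner ℝ (fderiv ℝ c x d) (Matrix.toEuclideanLin (R.Q k.1) (fderiv ℝ c x d)) +
      inner ℝ d (hessYC c y x d)
  transversal : ∀ v, jacT c x (Matrix.toEuclideanLin (RWRepresentation.activeMatrix k₀) v) = 0 →
    Matrix.toEuclideanLin (RWRepresentation.activeMatrix k₀) v = 0

/-- A sequence `(xⁱ, yⁱ, μⁱ)` generated by Newton's method: for each `i`, the pair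
`(xⁱ⁺¹, yⁱ⁺¹)` satisfies the optimality conditions of the subproblem at `(xⁱ, yⁱ)`, and `μⁱ⁺¹ ≥ 0`
is a corresponding multiplier family, i.e. it solves the multiplier system at the linearized
point. -/
structure IsNewtonSequence (c : Vec n → Vec m) (k₀ : R.ActivePiece p)
    (z : ℕ → Vec n × Vec m × R.Multiplier p) : Prop where
  optimality : ∀ i, SubproblemOptimality h c (z i).1 (z i).2.1 (z (i + 1)).1 (z (i + 1)).2.1
  multipliers : ∀ i, RWRepresentation.MultiplierSystem k₀ (linPoint c (z i).1 (z (i + 1)).1)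
    (z (i + 1)).2.1 (z (i + 1)).2.2
  multipliers_nonneg : ∀ i k j, 0 ≤ (z (i + 1)).2.2 k j

end Composite

end

end PLQComposite

open PLQComposite

/-! On the active manifold `activeManifold` at `c xbar` all active quadratic pieces of `h` agree.
The Newton subproblem restricted to it is therefore an equality-constrained quadratic program, and
its optimality system is linear: stationarity, `Aᵀ (ĉ - c xbar) = 0`, and `y = Q ĉ + b + A l` for
the single reference piece `k₀`. The method is thus Newton's method for a smooth equation, with
linear part `newtonOp`.

Curvature, transversality and `Null A = 0` make this operator invertible (`newtonOp_injective`). At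
the reference point curvature follows from second-order sufficiency, because `h''` along tangent
directions is the quadratic form of any active piece. Transversality follows from strict
criticality: a nonzero `A v` killed by `∇cᵀ` would give further points `ybar + t A v` of the set
that is assumed to be a singleton. Both conditions persist nearby
(`eventually_curvatureTransversality`), and Taylor estimates then give the quadratic rate
(`eventually_isActiveStep_norm_le`).

It remains to pass between the reduced system and the original subproblem. Gradients of active
pieces differ by elements of `Ran A` on the manifold, so one multiplier vector for `k₀` yields a
multiplier family for all active pieces. That family is close to the positive reference one, hence
positive, which by convexity gives a relative interior subgradient
(`mem_intrinsicInterior_subdifferential`) and a strong local minimum (`isStrongLocalMin_modelFn`).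
Conversely, positive multipliers force the linearized point onto the manifold
(`mem_activeManifold_of_pos_multiplier`). Both uniqueness claims thus reduce to unique solvability
of the linear system. -/

namespace PLQComposite

noncomputable section

/-! ### Analytic preliminaries -/

section Analysis

variable {E F : Type*} [NormedAddCommGroup E] [NormedSpace ℝ E]
  [NormedAddCommGroup F] [NormedSpace ℝ F]

/-- Finsler's lemma: a continuous quadratic function that is positive on the kernel of `L` becomes
positive definite after adding a multiple of `‖L v‖ ^ 2`. -/
lemma exists_le_add_mul_norm_sq [FiniteDimensional ℝ E] {q : E → ℝ} (hq : Continuous q)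
    (hom : ∀ (t : ℝ) v, q (t • v) = t ^ 2 * q v) (L : E →L[ℝ] F)
    (hpos : ∀ v, v ≠ 0 → L v = 0 → 0 < q v) :
    ∃ ρ : ℝ, 0 ≤ ρ ∧ ∃ σ : ℝ, 0 < σ ∧ ∀ v, σ * ‖v‖ ^ 2 ≤ q v + ρ * ‖L v‖ ^ 2 := by
  have hS : IsCompact (Metric.sphere (0 : E) 1) := isCompact_sphere 0 1
  have hcont : ∀ r : ℝ, Continuous fun v => q v + r * ‖L v‖ ^ 2 := fun r => by fun_prop
  -- The open sets where `q + N ‖L ·‖²` is positive increase with `N` and cover the sphere, so by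
  -- compactness one `N` suffices.
  obtain ⟨N, hN⟩ := hS.elim_directed_cover (fun N : ℕ => {v | 0 < q v + N * ‖L v‖ ^ 2})
    (fun N => isOpen_lt continuous_const (hcont N))
    (by
      intro v hv
      have hv0 : v ≠ 0 := by
        rintro rfl
        simp at hv
      rw [mem_iUnion]
      by_cases hL : L v = 0
      · exact ⟨0, by simpa using hpos v hv0 hL⟩
      · have h0 : 0 < ‖L v‖ ^ 2 := by positivity
        obtain ⟨N, hN⟩ := exists_nat_gt (-q v / ‖L v‖ ^ 2)
        refine ⟨N, ?_⟩
        rw [div_lt_iff₀ h0] at hN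
        simp only [mem_ofPred_eq]
        linarith)
    (directed_of_isDirected_le fun i j hij v hv => by
      simp only [mem_ofPred_eq] at hv ⊢
      have : (i : ℝ) * ‖L v‖ ^ 2 ≤ j * ‖L v‖ ^ 2 := by gcongr
      linarith)
  have hσ : ∃ σ : ℝ, 0 < σ ∧ ∀ v ∈ Metric.sphere (0 : E) 1, σ ≤ q v + N * ‖L v‖ ^ 2 := by
    rcases (Metric.sphere (0 : E) 1).eq_empty_or_nonempty with he | hne
    · exact ⟨1, one_pos, by simp [he]⟩
    · obtain ⟨v, hv, hmin⟩ := hS.exists_isMinOn hne (hcont N).continuousOn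
      exact ⟨_, hN hv, fun w hw => hmin hw⟩
  obtain ⟨σ, hσ0, hσ⟩ := hσ
  refine ⟨N, by positivity, σ, hσ0, fun v => ?_⟩
  by_cases hv : v = 0
  · subst hv
    have := hom 0 0
    simp_all
  · have hn : ‖v‖ ≠ 0 := norm_ne_zero_iff.2 hv
    have h1 := hσ (‖v‖⁻¹ • v) (by simp [norm_smul, hn])
    rw [hom, map_smul, norm_smul, norm_inv, norm_norm, mul_pow] at h1
    have h2 := mul_le_mul_of_nonneg_left h1 (sq_nonneg ‖v‖)
    calc σ * ‖v‖ ^ 2 = ‖v‖ ^ 2 * σ := mul_comm _ _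
      _ ≤ _ := h2
      _ = _ := by field_simp

/-- A positivity condition on the kernels of a continuous family of linear maps is stable. -/
lemma eventually_pos_on_ker [FiniteDimensional ℝ E] {X : Type*} [TopologicalSpace X]
    {q : X → E → ℝ} {L : X → E →L[ℝ] F} {x₀ : X} (hq : Continuous fun z : X × E => q z.1 z.2)
    (hL : Continuous L) (hom : ∀ x (t : ℝ) v, q x (t • v) = t ^ 2 * q x v)
    (hpos : ∀ v, v ≠ 0 → L x₀ v = 0 → 0 < q x₀ v) :
    ∀ᶠ x in 𝓝 x₀, ∀ v, v ≠ 0 → L x v = 0 → 0 < q x v := by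
  have hLc : Continuous fun z : X × E => L z.1 z.2 := by fun_prop
  -- The alternative `L x v ≠ 0` or `0 < q x v` is open jointly in `(x, v)`, unlike the original
  -- implication, so compactness of the sphere applies.
  have key : ∀ᶠ x in 𝓝 x₀, ∀ v ∈ Metric.sphere (0 : E) 1, L x v ≠ 0 ∨ 0 < q x v := by
    refine (isCompact_sphere (0 : E) 1).eventually_forall_of_forall_eventually fun v hv => ?_
    have hv0 : v ≠ 0 := by
      rintro rfl
      simp at hv
    by_cases h0 : L x₀ v = 0
    · filter_upwards [(hq.tendsto (x₀, v)).eventually (lt_mem_nhds (hpos v hv0 h0))] with z hz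
      exact Or.inr hz
    · filter_upwards [(hLc.tendsto (x₀, v)).eventually (isOpen_ne.mem_nhds h0)] with z hz
      exact Or.inl hz
  filter_upwards [key] with x hx v hv0 hv
  have hn : 0 < ‖v‖ := norm_pos_iff.2 hv0
  rcases hx (‖v‖⁻¹ • v) (by simp [norm_smul, hn.ne']) with h1 | h1
  · exact absurd (by rw [map_smul, hv, smul_zero]) h1
  · rw [hom] at h1
    exact pos_of_mul_pos_right h1 (by positivity)

/-- A quadratic estimate for the first-order Taylor remainder expanded at a moving point. -/
lemma eventually_taylor_le {f : E → F} (hf : ContDiff ℝ 2 f) (x₀ : E) :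
    ∃ K : ℝ, ∀ᶠ x in 𝓝 x₀, ‖f x₀ - f x - fderiv ℝ f x (x₀ - x)‖ ≤ K * ‖x - x₀‖ ^ 2 := by
  have h1 : ContDiff ℝ 1 (fderiv ℝ f) := hf.fderiv_right (by norm_num)
  obtain ⟨K, t, ht, hK⟩ := h1.contDiffAt.exists_lipschitzOnWith (x := x₀)
  obtain ⟨ε, hε, hball⟩ := Metric.mem_nhds_iff.1 ht
  refine ⟨K, ?_⟩
  filter_upwards [Metric.ball_mem_nhds x₀ hε] with x hx
  have hseg : segment ℝ x x₀ ⊆ t := fun y hy =>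
    hball ((convex_ball x₀ ε).segment_subset hx (Metric.mem_ball_self hε) hy)
  have := (convex_segment x x₀).norm_image_sub_le_of_norm_fderiv_le' (𝕜 := ℝ) (f := f)
    (φ := fderiv ℝ f x) (C := K * ‖x - x₀‖) (x := x) (y := x₀)
    (fun y _ => (hf.differentiable (by norm_num)) y)
    (fun y hy => ?_) (left_mem_segment ℝ x x₀) (right_mem_segment ℝ x x₀)
  · rw [norm_sub_rev x₀ x] at this
    calc _ ≤ _ := this
      _ = _ := by ring
  · have h2 := hK.norm_sub_le (hseg hy) (hseg (left_mem_segment ℝ x x₀))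
    refine h2.trans ?_
    gcongr
    have := norm_sub_le_of_mem_segment hy
    rwa [norm_sub_rev x x₀]

/-- An injective operator on a finite-dimensional space stays uniformly bounded below under small
perturbations. -/
lemma eventually_le_norm_apply [FiniteDimensional ℝ E] {X : Type*} [TopologicalSpace X]
    {T : X → E →L[ℝ] F} {x₀ : X} (hT : ContinuousAt T x₀) (hinj : ∀ v, T x₀ v = 0 → v = 0) :
    ∃ κ : ℝ, 0 < κ ∧ ∀ᶠ x in 𝓝 x₀, ∀ v, κ * ‖v‖ ≤ ‖T x v‖ := by
  obtain ⟨K, hK0, hK⟩ := (T x₀ : E →ₗ[ℝ] F).exists_antilipschitzWith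
    (LinearMap.ker_eq_bot'.2 hinj)
  have hK0' : (0 : ℝ) < K := hK0
  have hb : ∀ v, ‖v‖ ≤ K * ‖T x₀ v‖ := fun v => by
    simpa using hK.le_mul_dist v 0
  refine ⟨(K : ℝ)⁻¹ / 2, by positivity, ?_⟩
  filter_upwards [Metric.tendsto_nhds.1 hT ((K : ℝ)⁻¹ / 2) (by positivity)] with x hx v
  rw [dist_eq_norm] at hx
  have h1 : ‖T x₀ v‖ ≤ ‖T x v‖ + (K : ℝ)⁻¹ / 2 * ‖v‖ := by
    have h2 : ‖(T x - T x₀) v‖ ≤ (K : ℝ)⁻¹ / 2 * ‖v‖ :=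
      ((T x - T x₀).le_opNorm v).trans (by gcongr)
    have h3 : T x₀ v = T x v - (T x - T x₀) v := by simp
    rw [h3]
    exact (norm_sub_le _ _).trans (by gcongr)
  have h4 : (K : ℝ)⁻¹ * ‖v‖ ≤ ‖T x₀ v‖ := by
    rw [inv_mul_le_iff₀ hK0']
    exact hb v
  linarith

/-- If `t a + t² b ≥ 0` for all small `t > 0` then `a ≥ 0`. -/
lemma nonneg_of_eventually_mul_add_sq {a b : ℝ} (hab : ∀ᶠ t in 𝓝[>] (0 : ℝ), 0 ≤ t * a + t ^ 2 * b) :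
    0 ≤ a := by
  have h1 : Tendsto (fun t : ℝ => a + t * b) (𝓝[>] 0) (𝓝 a) := by
    have : Continuous fun t : ℝ => a + t * b := by fun_prop
    simpa using (this.tendsto 0).mono_left nhdsWithin_le_nhds
  refine ge_of_tendsto h1 ?_
  filter_upwards [hab, self_mem_nhdsWithin] with t ht ht0
  have ht0' : (0 : ℝ) < t := ht0
  have : 0 ≤ t * (a + t * b) := by linarith [ht, (by ring : t * (a + t * b) = t * a + t ^ 2 * b)]
  exact nonneg_of_mul_nonneg_right this ht0'

end Analysis

/-! ### Relative interiors in terms of ambient neighborhoods. -/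

section IntrinsicInterior

variable {E : Type*} [NormedAddCommGroup E] [NormedSpace ℝ E] {s : Set E} {x : E}

lemma mem_intrinsicInterior_iff_eventually :
    x ∈ intrinsicInterior ℝ s ↔
      x ∈ affineSpan ℝ s ∧ ∀ᶠ y in 𝓝 x, y ∈ affineSpan ℝ s → y ∈ s := by
  rw [mem_intrinsicInterior]
  constructor
  · rintro ⟨y, hy, rfl⟩
    refine ⟨y.2, ?_⟩
    rw [mem_interior_iff_mem_nhds, mem_nhds_subtype] at hy
    obtain ⟨u, hu, hus⟩ := hy
    filter_upwards [hu] with z hz hza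
    exact hus (show (⟨z, hza⟩ : affineSpan ℝ s) ∈ _ from hz)
  · rintro ⟨hx, hev⟩
    refine ⟨⟨x, hx⟩, ?_, rfl⟩
    rw [mem_interior_iff_mem_nhds, mem_nhds_subtype]
    exact ⟨_, hev, fun z hz => hz z.2⟩

/-- Points of `s` close to a relative interior point are relative interior points. -/
lemma eventually_mem_intrinsicInterior (hx : x ∈ intrinsicInterior ℝ s) :
    ∀ᶠ y in 𝓝 x, y ∈ s → y ∈ intrinsicInterior ℝ s := by
  rw [mem_intrinsicInterior_iff_eventually] at hx
  filter_upwards [hx.2.eventually_nhds] with y hy hys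
  exact mem_intrinsicInterior_iff_eventually.2 ⟨subset_affineSpan ℝ s hys, hy⟩

end IntrinsicInterior

/-! ### Derivatives of `z ↦ ⟨y, c z⟩` -/

section Hessian

variable {n m : ℕ} {c : Vec n → Vec m}

/-- The adjoint as a continuous linear map. -/
def adjointCLM (n m : ℕ) : (Vec n →L[ℝ] Vec m) →L[ℝ] (Vec m →L[ℝ] Vec n) :=
  LinearMap.toContinuousLinearMap
    { toFun := fun T => ContinuousLinearMap.adjoint T
      map_add' := fun S T => by simp
      map_smul' := fun r T => by simp }

@[simp] lemma adjointCLM_apply (T : Vec n →L[ℝ] Vec m) :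
    adjointCLM n m T = ContinuousLinearMap.adjoint T := rfl

lemma inner_jacT (x : Vec n) (y : Vec m) (d : Vec n) :
    inner ℝ (jacT c x y) d = inner ℝ y (fderiv ℝ c x d) :=
  ContinuousLinearMap.adjoint_inner_left _ _ _

lemma gradient_inner_left (hc : Differentiable ℝ c) (y : Vec m) (x : Vec n) :
    gradient (fun z => (inner ℝ y (c z) : ℝ)) x = jacT c x y := by
  refine ext_inner_right ℝ fun d => ?_
  rw [inner_jacT, gradient, InnerProductSpace.toDual_symm_apply,
    fderiv_inner_apply ℝ (by fun_prop) (hc x)]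
  simp

lemma contDiff_fderiv (hc : ContDiff ℝ 3 c) : ContDiff ℝ 2 (fderiv ℝ c) :=
  hc.fderiv_right (by norm_num)

/-- This is where three derivatives of `c` matter: the quadratic Taylor estimate will be applied to
`x ↦ ∇c(x)ᵀ y`. -/
lemma contDiff_jacT (hc : ContDiff ℝ 3 c) (y : Vec m) : ContDiff ℝ 2 fun x => jacT c x y :=
  ((adjointCLM n m).contDiff.comp (contDiff_fderiv hc)).clm_apply contDiff_const

lemma fderiv_jacT (hc : ContDiff ℝ 3 c) (y : Vec m) (x : Vec n) :
    fderiv ℝ (fun x => jacT c x y) x = hessYC c y x := by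
  have : (fun x' => gradient (fun z => (inner ℝ y (c z) : ℝ)) x') = fun x => jacT c x y :=
    funext fun x' => gradient_inner_left (hc.differentiable (by norm_num)) y x'
  rw [hessYC, this]

/-- Differentiating `∇c(x)ᵀ y` exposes the linear dependence on `y`; linearity, symmetry, joint
continuity and the norm bound are all read off from this formula. -/
lemma hessYC_eq_flip (hc : ContDiff ℝ 3 c) (y : Vec m) (x : Vec n) :
    hessYC c y x = (adjointCLM n m ∘L fderiv ℝ (fderiv ℝ c) x).flip y := by
  rw [← fderiv_jacT hc]
  have h1 : HasFDerivAt (fderiv ℝ c) (fderiv ℝ (fderiv ℝ c) x) x :=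
    ((contDiff_fderiv hc).differentiable (by norm_num) x).hasFDerivAt
  have h2 := ((adjointCLM n m).hasFDerivAt.comp x h1).clm_apply (hasFDerivAt_const y x)
  refine HasFDerivAt.fderiv (h2.congr_fderiv ?_)
  ext d i
  simp

lemma hessYC_sub (hc : ContDiff ℝ 3 c) (y y' : Vec m) (x d : Vec n) :
    hessYC c (y - y') x d = hessYC c y x d - hessYC c y' x d := by
  simp [hessYC_eq_flip hc]

lemma inner_hessYC (hc : ContDiff ℝ 3 c) (y : Vec m) (x d e : Vec n) :
    inner ℝ (hessYC c y x d) e = inner ℝ y (fderiv ℝ (fderiv ℝ c) x d e) := by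
  simp [hessYC_eq_flip hc, ContinuousLinearMap.adjoint_inner_left]

lemma inner_hessYC_comm (hc : ContDiff ℝ 3 c) (y : Vec m) (x d e : Vec n) :
    inner ℝ (hessYC c y x d) e = inner ℝ d (hessYC c y x e) := by
  have hs : IsSymmSndFDerivAt ℝ c x :=
    hc.contDiffAt.isSymmSndFDerivAt (by simp; norm_num)
  rw [real_inner_comm (hessYC c y x e) d, inner_hessYC hc, inner_hessYC hc, hs d e]

lemma continuous_hessYC (hc : ContDiff ℝ 3 c) :
    Continuous fun u : Vec n × Vec m => hessYC c u.2 u.1 := by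
  simp only [hessYC_eq_flip hc]
  have h1 : Continuous (fderiv ℝ (fderiv ℝ c)) :=
    (contDiff_fderiv hc).continuous_fderiv (by norm_num)
  have h2 : Continuous fun x : Vec n => (adjointCLM n m ∘L fderiv ℝ (fderiv ℝ c) x).flip :=
    (ContinuousLinearMap.flipₗᵢ ℝ (Vec n) (Vec m) (Vec n)).continuous.comp
      (continuous_const.clm_comp h1)
  exact (h2.comp continuous_fst).clm_apply continuous_snd

/-- Near any point, `∇²(yc)` is bounded linearly in `y`. -/
lemma eventually_norm_hessYC_le (hc : ContDiff ℝ 3 c) (x₀ : Vec n) :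
    ∃ K : ℝ, ∀ᶠ x in 𝓝 x₀, ∀ y d, ‖hessYC c y x d‖ ≤ K * ‖y‖ * ‖d‖ := by
  have h1 : Continuous (fderiv ℝ (fderiv ℝ c)) :=
    (contDiff_fderiv hc).continuous_fderiv (by norm_num)
  have h2 : Continuous fun x : Vec n => ‖(adjointCLM n m ∘L fderiv ℝ (fderiv ℝ c) x).flip‖ :=
    ((ContinuousLinearMap.flipₗᵢ ℝ (Vec n) (Vec m) (Vec n)).continuous.comp
      (continuous_const.clm_comp h1)).norm
  refine ⟨‖(adjointCLM n m ∘L fderiv ℝ (fderiv ℝ c) x₀).flip‖ + 1, ?_⟩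
  filter_upwards [(h2.tendsto x₀).eventually (gt_mem_nhds (lt_add_one _))] with x hx y d
  rw [hessYC_eq_flip hc]
  refine (ContinuousLinearMap.le_opNorm₂ _ y d).trans ?_
  gcongr

end Hessian

end

end PLQComposite

namespace PLQComposite

noncomputable section

/-! ### Geometry of piecewise linear-quadratic functions -/

namespace RWRepresentation

variable {m : ℕ} {h : Vec m → EReal} {R : RWRepresentation h} {p₀ : Vec m}

/-- The quadratic function that represents `h` on the `k`-th piece. -/
def pieceValue (R : RWRepresentation h) (k : Fin R.numPieces) (p : Vec m) : ℝ :=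
  1 / 2 * inner ℝ p (Matrix.toEuclideanLin (R.Q k) p) + inner ℝ (R.b k) p + R.β k

/-- The gradient of the quadratic function that represents `h` on the `k`-th piece. -/
def pieceGrad (R : RWRepresentation h) (k : Fin R.numPieces) (p : Vec m) : Vec m :=
  Matrix.toEuclideanLin (R.Q k) p + R.b k

lemma eq_pieceValue {k : Fin R.numPieces} {p : Vec m} (hp : p ∈ R.piece k) :
    h p = (R.pieceValue k p : EReal) := R.eq_on_piece k p hp

lemma inner_Q_comm (k : Fin R.numPieces) (v w : Vec m) :
    inner ℝ (Matrix.toEuclideanLin (R.Q k) v) w = inner ℝ v (Matrix.toEuclideanLin (R.Q k) w) := by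
  have : (R.Q k).IsHermitian := by
    rw [Matrix.IsHermitian, Matrix.conjTranspose_eq_transpose_of_trivial]
    exact R.Q_symm k
  exact Matrix.isSymmetric_toEuclideanLin_iff.2 this v w

lemma pieceValue_add (k : Fin R.numPieces) (p w : Vec m) :
    R.pieceValue k (p + w) = R.pieceValue k p + inner ℝ (R.pieceGrad k p) w +
      1 / 2 * inner ℝ w (Matrix.toEuclideanLin (R.Q k) w) := by
  have h1 := inner_Q_comm k p w
  have h2 : inner ℝ w (Matrix.toEuclideanLin (R.Q k) p) =
      inner ℝ (Matrix.toEuclideanLin (R.Q k) p) w := real_inner_comm _ _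
  simp only [pieceValue, pieceGrad, map_add, inner_add_left, inner_add_right]
  linarith

lemma pieceValue_add_smul (k : Fin R.numPieces) (p w : Vec m) (t : ℝ) :
    R.pieceValue k (p + t • w) = R.pieceValue k p + t * inner ℝ (R.pieceGrad k p) w +
      t ^ 2 * (1 / 2 * inner ℝ w (Matrix.toEuclideanLin (R.Q k) w)) := by
  rw [pieceValue_add]
  simp only [map_smul, inner_smul_left, inner_smul_right, conj_trivial]
  ring

lemma mem_piece {k : Fin R.numPieces} {p : Vec m} :
    p ∈ R.piece k ↔ ∀ j, R.ω k j * inner ℝ (R.a j) p ≤ R.ω k j * R.α j := by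
  simp [piece, signedPolyhedron, inner_smul_left]

lemma mem_activeManifold {q : Vec m} :
    q ∈ R.activeManifold p₀ ↔ (∀ j, inner ℝ (R.a j) p₀ = R.α j → inner ℝ (R.a j) q = R.α j) ∧
      ∀ k : R.ActivePiece p₀, ∀ j, inner ℝ (R.a j) p₀ ≠ R.α j →
        R.ω k.1 j * inner ℝ (R.a j) q < R.ω k.1 j * R.α j := by
  simp [activeManifold, inner_smul_left]

lemma isClosed_piece (k : Fin R.numPieces) : IsClosed (R.piece k) := by
  have : R.piece k = ⋂ j, {p | R.ω k j * inner ℝ (R.a j) p ≤ R.ω k j * R.α j} := by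
    ext p
    rw [mem_piece, mem_iInter]
    rfl
  rw [this]
  exact isClosed_iInter fun j => isClosed_le (by fun_prop) continuous_const

lemma convex_piece (k : Fin R.numPieces) : Convex ℝ (R.piece k) := by
  intro p hp q hq s t hs ht hst
  rw [mem_piece] at hp hq ⊢
  intro j
  have h1 := mul_le_mul_of_nonneg_left (hp j) hs
  have h2 := mul_le_mul_of_nonneg_left (hq j) ht
  rw [inner_add_right, inner_smul_right, inner_smul_right]
  calc _ = s * (R.ω k j * inner ℝ (R.a j) p) + t * (R.ω k j * inner ℝ (R.a j) q) := by ring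
    _ ≤ s * (R.ω k j * R.α j) + t * (R.ω k j * R.α j) := add_le_add h1 h2
    _ = (s + t) * (R.ω k j * R.α j) := by ring
    _ = _ := by rw [hst, one_mul]

lemma mem_piece_of_mem_activeManifold {p : Vec m} (hp : p ∈ R.activeManifold p₀)
    (k : R.ActivePiece p₀) : p ∈ R.piece k.1 := by
  rw [mem_activeManifold] at hp
  rw [mem_piece]
  intro j
  by_cases hj : inner ℝ (R.a j) p₀ = R.α j
  · rw [hp.1 j hj]
  · exact (hp.2 k j hj).le

lemma mem_effDomain_of_mem_piece {k : Fin R.numPieces} {p : Vec m} (hp : p ∈ R.piece k) :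
    p ∈ effDomain h := by
  rw [R.domain_eq]
  exact mem_iUnion.2 ⟨k, hp⟩

/-! #### The matrices of active constraint normals -/

lemma ω_mul_self (k : Fin R.numPieces) (j : Fin R.numHyperplanes) : R.ω k j * R.ω k j = 1 := by
  rcases R.ω_sign k j with h1 | h1 <;> simp [h1]

/-- Removes the reference piece: each condition on piece `k` can be written with that piece's own
constraint normals. -/
lemma activeMatrix_mul_signMatrix (k₀ k : R.ActivePiece p₀) :
    activeMatrix k₀ * signMatrix k₀ k = activeMatrix k := by
  ext i j
  rw [signMatrix, Matrix.mul_diagonal]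
  simp only [activeMatrix, Matrix.of_apply]
  linear_combination (R.ω k.1 j.1 * R.a j.1 i) * ω_mul_self k₀.1 j.1

lemma signMatrix_mul_self (k₀ k : R.ActivePiece p₀) :
    signMatrix k₀ k * signMatrix k₀ k = 1 := by
  rw [signMatrix, Matrix.diagonal_mul_diagonal, ← Matrix.diagonal_one]
  congr 1
  ext j
  linear_combination (R.ω k.1 j.1 * R.ω k.1 j.1) * ω_mul_self k₀.1 j.1 + ω_mul_self k.1 j.1

/-- The linear map `A`. -/
abbrev activeLin (k₀ : R.ActivePiece p₀) : EuclideanSpace ℝ (R.ActiveIdx p₀) →ₗ[ℝ] Vec m :=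
  Matrix.toEuclideanLin (activeMatrix k₀)

/-- The linear map `Aᵀ`. -/
abbrev activeLinT (k₀ : R.ActivePiece p₀) : Vec m →ₗ[ℝ] EuclideanSpace ℝ (R.ActiveIdx p₀) :=
  Matrix.toEuclideanLin (activeMatrix k₀).transpose

lemma activeLinT_eq_adjoint (k₀ : R.ActivePiece p₀) :
    activeLinT k₀ = LinearMap.adjoint (activeLin k₀) := by
  rw [← Matrix.toEuclideanLin_conjTranspose_eq_adjoint,
    Matrix.conjTranspose_eq_transpose_of_trivial]

lemma inner_activeLin (k₀ : R.ActivePiece p₀) (v : EuclideanSpace ℝ (R.ActiveIdx p₀)) (w : Vec m) :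
    inner ℝ (activeLin k₀ v) w = inner ℝ v (activeLinT k₀ w) := by
  rw [activeLinT_eq_adjoint, LinearMap.adjoint_inner_right]

lemma activeLinT_apply (k₀ : R.ActivePiece p₀) (w : Vec m) (j : R.ActiveIdx p₀) :
    activeLinT k₀ w j = R.ω k₀.1 j.1 * inner ℝ (R.a j.1) w := by
  simp only [Matrix.ofLp_toLpLin, Matrix.toLin'_apply, Matrix.mulVec, dotProduct,
    Matrix.transpose_apply, activeMatrix, Matrix.of_apply, PiLp.inner_apply, Finset.mul_sum]
  refine Finset.sum_congr rfl fun i _ => ?_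
  simp
  ring

lemma inner_activeLin_eq_sum (k₀ : R.ActivePiece p₀) (v : EuclideanSpace ℝ (R.ActiveIdx p₀))
    (w : Vec m) :
    inner ℝ (activeLin k₀ v) w = ∑ j, v j * (R.ω k₀.1 j.1 * inner ℝ (R.a j.1) w) := by
  rw [inner_activeLin, PiLp.inner_apply]
  refine Finset.sum_congr rfl fun j _ => ?_
  rw [activeLinT_apply]
  simp [mul_comm]

lemma activeLinT_eq_zero_iff (k₀ : R.ActivePiece p₀) (w : Vec m) :
    activeLinT k₀ w = 0 ↔ ∀ j : R.ActiveIdx p₀, inner ℝ (R.a j.1) w = 0 := by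
  constructor
  · intro hw j
    have h1 := activeLinT_apply k₀ w j
    rw [hw] at h1
    have h2 := ω_mul_self k₀.1 j.1
    have h3 : R.ω k₀.1 j.1 * inner ℝ (R.a j.1) w = 0 := by simpa using h1.symm
    rcases mul_eq_zero.1 h3 with h4 | h4
    · simp [h4] at h2
    · exact h4
  · intro hw
    ext j
    rw [activeLinT_apply, hw j]
    simp

/-- A vector orthogonal to `Null Aᵀ` lies in `Ran A`. -/
lemma mem_range_activeLin {k₀ : R.ActivePiece p₀} {z : Vec m}
    (hz : ∀ w, activeLinT k₀ w = 0 → inner ℝ z w = 0) : z ∈ LinearMap.range (activeLin k₀) := by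
  have h1 := LinearMap.orthogonal_ker (activeLinT k₀)
  rw [activeLinT_eq_adjoint k₀, LinearMap.adjoint_adjoint] at h1
  rw [← h1, Submodule.mem_orthogonal]
  intro w hw
  rw [real_inner_comm]
  exact hz w (by rwa [activeLinT_eq_adjoint])

lemma multiplierSystem_iff {k₀ : R.ActivePiece p₀} {q y : Vec m} {μ : R.Multiplier p₀} :
    MultiplierSystem k₀ q y μ ↔
      ∀ k : R.ActivePiece p₀, y = R.pieceGrad k.1 q + activeLin k (μ k) := by
  simp only [MultiplierSystem, pieceGrad, activeMatrix_mul_signMatrix]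

lemma activeMatrix_leftInverse {k₀ : R.ActivePiece p₀} (hA : Nondegenerate k₀) :
    ((activeMatrix k₀).transpose * activeMatrix k₀)⁻¹ *
      ((activeMatrix k₀).transpose * activeMatrix k₀) = 1 := by
  refine Matrix.nonsing_inv_mul _ ?_
  rw [← Matrix.isUnit_iff_isUnit_det]
  have h1 : Function.Injective (activeMatrix k₀).mulVec := by
    rw [← Matrix.coe_mulVecLin, ← LinearMap.ker_eq_bot, LinearMap.ker_eq_bot']
    intro v hv
    have h2 := hA (WithLp.toLp 2 v) (by
      rw [Matrix.toLpLin_toLp]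
      simpa using hv)
    simpa using h2
  have h2 := Matrix.PosDef.conjTranspose_mul_self (activeMatrix k₀) h1
  rw [Matrix.conjTranspose_eq_transpose_of_trivial] at h2
  exact h2.isUnit

lemma toEuclideanLin_mul_apply {ι κ τ : Type*} [Fintype ι] [DecidableEq ι] [Fintype κ]
    [DecidableEq κ] (M : Matrix τ ι ℝ) (N : Matrix ι κ ℝ) (v : EuclideanSpace ℝ κ) :
    Matrix.toEuclideanLin (M * N) v = Matrix.toEuclideanLin M (Matrix.toEuclideanLin N v) := by
  simp [Matrix.toLpLin_mul (q := 2)]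

/-- `P_k (Aᵀ A)⁻¹ Aᵀ` is a left inverse of `A P_k`, since `P_k² = 1`; multipliers are therefore
determined by the primal-dual pair. -/
lemma eq_multiplierOf {k₀ : R.ActivePiece p₀} (hA : Nondegenerate k₀) {q y : Vec m}
    {μ : R.Multiplier p₀} (hμ : MultiplierSystem k₀ q y μ) : multiplierOf k₀ q y = μ := by
  funext k
  have h1 := hμ k
  rw [multiplierOf, sub_eq_of_eq_add' h1, ← toEuclideanLin_mul_apply]
  have h2 : signMatrix k₀ k * ((activeMatrix k₀).transpose * activeMatrix k₀)⁻¹ *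
      (activeMatrix k₀).transpose * (activeMatrix k₀ * signMatrix k₀ k) = 1 := by
    calc _ = signMatrix k₀ k * (((activeMatrix k₀).transpose * activeMatrix k₀)⁻¹ *
          ((activeMatrix k₀).transpose * activeMatrix k₀)) * signMatrix k₀ k := by
            simp only [Matrix.mul_assoc]
      _ = 1 := by rw [activeMatrix_leftInverse hA, Matrix.mul_one, signMatrix_mul_self]
  rw [h2]
  simp

/-- `A (Aᵀ A)⁻¹ Aᵀ` acts as the identity on `Ran A`, so the formula solves the system once all
residuals lie in that range. -/
lemma multiplierSystem_multiplierOf {k₀ : R.ActivePiece p₀} (hA : Nondegenerate k₀) {q y : Vec m}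
    (hy : ∀ k : R.ActivePiece p₀, y - R.pieceGrad k.1 q ∈ LinearMap.range (activeLin k₀)) :
    MultiplierSystem k₀ q y (multiplierOf k₀ q y) := by
  intro k
  obtain ⟨ν, hν⟩ := hy k
  have h1 : y - (Matrix.toEuclideanLin (R.Q k.1) q + R.b k.1) = activeLin k₀ ν := hν.symm
  rw [multiplierOf, h1, ← toEuclideanLin_mul_apply, ← toEuclideanLin_mul_apply]
  have h2 : activeMatrix k₀ * signMatrix k₀ k * (signMatrix k₀ k *
      ((activeMatrix k₀).transpose * activeMatrix k₀)⁻¹ * (activeMatrix k₀).transpose) *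
        activeMatrix k₀ = activeMatrix k₀ := by
    calc _ = activeMatrix k₀ * (signMatrix k₀ k * signMatrix k₀ k) *
          (((activeMatrix k₀).transpose * activeMatrix k₀)⁻¹ *
          ((activeMatrix k₀).transpose * activeMatrix k₀)) := by
            simp only [Matrix.mul_assoc]
      _ = activeMatrix k₀ := by
        rw [activeMatrix_leftInverse hA, Matrix.mul_one, signMatrix_mul_self, Matrix.mul_one]
  rw [h2, ← h1]
  abel

lemma continuous_multiplierOf (k₀ : R.ActivePiece p₀) {X : Type*} [TopologicalSpace X]
    {f g : X → Vec m} (hf : Continuous f) (hg : Continuous g) :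
    Continuous fun x => multiplierOf k₀ (f x) (g x) := by
  refine continuous_pi fun k => ?_
  have h1 := (Matrix.toEuclideanLin (R.Q k.1)).continuous_of_finiteDimensional
  exact (LinearMap.continuous_of_finiteDimensional _).comp
    (hg.sub ((h1.comp hf).add continuous_const))

lemma isOpen_pos_multiplier : IsOpen {μ : R.Multiplier p₀ | ∀ k j, 0 < μ k j} := by
  simp only [ofPred_forall]
  exact isOpen_iInter_of_finite fun k => isOpen_iInter_of_finite fun j =>
    isOpen_lt continuous_const (by fun_prop)

/-! #### Localization near a point of the domain -/

/-- A neighborhood of `p₀` on which the domain is covered by the pieces active at `p₀` and the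
constraints inactive at `p₀` remain inactive. -/
structure IsAdapted (R : RWRepresentation h) (p₀ : Vec m) (U : Set (Vec m)) : Prop where
  isOpen : IsOpen U
  mem : p₀ ∈ U
  cover : ∀ p ∈ U, p ∈ effDomain h → ∃ k : R.ActivePiece p₀, p ∈ R.piece k.1
  inactive : ∀ p ∈ U, ∀ k : R.ActivePiece p₀, ∀ j, inner ℝ (R.a j) p₀ ≠ R.α j →
    R.ω k.1 j * inner ℝ (R.a j) p < R.ω k.1 j * R.α j

/-- The finitely many pieces missing `p₀` are closed, and each inactive constraint of an active
piece is strict at `p₀`. -/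
lemma exists_isAdapted (R : RWRepresentation h) (p₀ : Vec m) : ∃ U, R.IsAdapted p₀ U := by
  have h1 : ∀ᶠ p in 𝓝 p₀, ∀ k, p₀ ∉ R.piece k → p ∉ R.piece k := by
    refine eventually_all.2 fun k => ?_
    by_cases hk : p₀ ∈ R.piece k
    · exact Eventually.of_forall fun p hp => absurd hk hp
    · filter_upwards [(isClosed_piece k).isOpen_compl.mem_nhds hk] with p hp _
      exact hp
  have h2 : ∀ᶠ p in 𝓝 p₀, ∀ k : R.ActivePiece p₀, ∀ j, inner ℝ (R.a j) p₀ ≠ R.α j →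
      R.ω k.1 j * inner ℝ (R.a j) p < R.ω k.1 j * R.α j := by
    refine eventually_all.2 fun k => eventually_all.2 fun j => ?_
    by_cases hj : inner ℝ (R.a j) p₀ = R.α j
    · exact Eventually.of_forall fun p hp => absurd hj hp
    · have h3 : R.ω k.1 j * inner ℝ (R.a j) p₀ < R.ω k.1 j * R.α j := by
        refine lt_of_le_of_ne (mem_piece.1 k.2 j) fun he => hj ?_
        refine mul_left_cancel₀ (fun h0 => ?_) he
        have := ω_mul_self k.1 j
        simp [h0] at this
      have h4 : Continuous fun p => R.ω k.1 j * (inner ℝ (R.a j) p : ℝ) := by fun_prop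
      filter_upwards [(h4.tendsto p₀).eventually (gt_mem_nhds h3)] with p hp _
      exact hp
  obtain ⟨U, hU, hUo, hUm⟩ := eventually_nhds_iff.1 (h1.and h2)
  refine ⟨U, hUo, hUm, fun p hp hd => ?_, fun p hp => (hU p hp).2⟩
  rw [R.domain_eq] at hd
  obtain ⟨k, hk⟩ := mem_iUnion.1 hd
  exact ⟨⟨k, by_contra fun h0 => (hU p hp).1 k h0 hk⟩, hk⟩

lemma IsAdapted.mem_activeManifold {U : Set (Vec m)} (hU : R.IsAdapted p₀ U) {p : Vec m}
    (hp : p ∈ U) (hact : ∀ j : R.ActiveIdx p₀, inner ℝ (R.a j.1) p = R.α j.1) :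
    p ∈ R.activeManifold p₀ :=
  RWRepresentation.mem_activeManifold.2 ⟨fun j hj => hact ⟨j, hj⟩, hU.inactive p hp⟩

lemma eventually_add_smul_mem_activeManifold {k₀ : R.ActivePiece p₀} {p w : Vec m}
    (hp : p ∈ R.activeManifold p₀) (hw : activeLinT k₀ w = 0) :
    ∀ᶠ t in 𝓝 (0 : ℝ), p + t • w ∈ R.activeManifold p₀ := by
  rw [mem_activeManifold] at hp
  rw [activeLinT_eq_zero_iff] at hw
  have h2 : ∀ᶠ t in 𝓝 (0 : ℝ), ∀ k : R.ActivePiece p₀, ∀ j, inner ℝ (R.a j) p₀ ≠ R.α j →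
      R.ω k.1 j * inner ℝ (R.a j) (p + t • w) < R.ω k.1 j * R.α j := by
    refine eventually_all.2 fun k => eventually_all.2 fun j => ?_
    by_cases hj : inner ℝ (R.a j) p₀ = R.α j
    · exact Eventually.of_forall fun p hp => absurd hj hp
    · have h4 : Continuous fun t : ℝ => R.ω k.1 j * (inner ℝ (R.a j) (p + t • w) : ℝ) := by
        fun_prop
      have h5 : R.ω k.1 j * (inner ℝ (R.a j) (p + (0 : ℝ) • w) : ℝ) < R.ω k.1 j * R.α j := by
        simpa using hp.2 k j hj
      filter_upwards [(h4.tendsto 0).eventually (gt_mem_nhds h5)] with p hp _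
      exact hp
  filter_upwards [h2] with t ht
  refine mem_activeManifold.2 ⟨fun j hj => ?_, ht⟩
  rw [inner_add_right, inner_smul_right, hw ⟨j, hj⟩, hp.1 j hj]
  simp

/-- Moves in both directions turn one-sided first-order inequalities into equalities. -/
lemma exists_add_sub_smul_mem_activeManifold {k₀ : R.ActivePiece p₀} {p w : Vec m}
    (hp : p ∈ R.activeManifold p₀) (hw : activeLinT k₀ w = 0) :
    ∃ t : ℝ, 0 < t ∧ p + t • w ∈ R.activeManifold p₀ ∧ p + (-t) • w ∈ R.activeManifold p₀ := by
  have h1 := eventually_add_smul_mem_activeManifold hp hw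
  have h2 : Tendsto (fun t : ℝ => -t) (𝓝 0) (𝓝 0) := by
    simpa using (continuous_neg (G := ℝ)).tendsto 0
  have h3 := (h1.and (h2.eventually h1)).filter_mono (nhdsWithin_le_nhds (s := Ioi 0))
  obtain ⟨t, ht, ht0⟩ := (h3.and self_mem_nhdsWithin).exists
  exact ⟨t, ht0, ht.1, ht.2⟩

/-- Two active pieces both equal `h` on the manifold, so their gradients have the same tangential
component. -/
lemma pieceGrad_sub_pieceGrad_mem_range {p : Vec m} (k₀ : R.ActivePiece p₀)
    (hp : p ∈ R.activeManifold p₀) (k k' : R.ActivePiece p₀) :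
    R.pieceGrad k.1 p - R.pieceGrad k'.1 p ∈ LinearMap.range (activeLin k₀) := by
  refine mem_range_activeLin fun w hw => ?_
  obtain ⟨t, ht, h1, h2⟩ := exists_add_sub_smul_mem_activeManifold hp hw
  have key : ∀ q ∈ R.activeManifold p₀, R.pieceValue k.1 q = R.pieceValue k'.1 q := fun q hq => by
    have h3 := eq_pieceValue (mem_piece_of_mem_activeManifold hq k)
    rw [eq_pieceValue (mem_piece_of_mem_activeManifold hq k')] at h3
    exact_mod_cast h3.symm
  have e0 := key p hp
  have e1 := key _ h1
  have e2 := key _ h2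
  rw [pieceValue_add_smul, pieceValue_add_smul] at e1 e2
  rw [inner_sub_left]
  -- Subtracting the expansions at `t` and `-t` cancels the quadratic terms.
  have h4 : (2 * t) * (inner ℝ (R.pieceGrad k.1 p) w - inner ℝ (R.pieceGrad k'.1 p) w) = 0 := by
    linear_combination e1 - e2
  exact (mul_eq_zero.1 h4).resolve_left (by positivity)

/-! #### Subgradients -/

/-- Along the segment to `q`, which stays in one convex piece, the subgradient inequality is a
quadratic polynomial in `t`; this is its leading coefficient. -/
lemma inner_pieceGrad_sub_nonneg {k : Fin R.numPieces} {p q y : Vec m}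
    (hy : y ∈ subdifferential h p) (hp : p ∈ R.piece k) (hq : q ∈ R.piece k) :
    0 ≤ inner ℝ (R.pieceGrad k p - y) (q - p) := by
  refine nonneg_of_eventually_mul_add_sq
    (b := 1 / 2 * inner ℝ (q - p) (Matrix.toEuclideanLin (R.Q k) (q - p))) ?_
  filter_upwards [Ioo_mem_nhdsGT (zero_lt_one (α := ℝ))] with t ht
  have hpt : p + t • (q - p) ∈ R.piece k :=
    (convex_piece k).add_smul_sub_mem hp hq ⟨ht.1.le, ht.2.le⟩
  have h1 := hy.2 (p + t • (q - p))
  rw [eq_pieceValue hp, eq_pieceValue hpt] at h1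
  have h2 : R.pieceValue k p + inner ℝ y (p + t • (q - p) - p) ≤
      R.pieceValue k (p + t • (q - p)) := by exact_mod_cast h1
  rw [pieceValue_add_smul, add_sub_cancel_left, inner_smul_right] at h2
  rw [inner_sub_left]
  linarith

lemma sub_pieceGrad_mem_range {p y : Vec m} (k₀ k : R.ActivePiece p₀)
    (hp : p ∈ R.activeManifold p₀) (hy : y ∈ subdifferential h p) :
    y - R.pieceGrad k.1 p ∈ LinearMap.range (activeLin k₀) := by
  refine mem_range_activeLin fun w hw => ?_
  obtain ⟨t, ht, h1, h2⟩ := exists_add_sub_smul_mem_activeManifold hp hw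
  have e1 := inner_pieceGrad_sub_nonneg hy (mem_piece_of_mem_activeManifold hp k)
    (mem_piece_of_mem_activeManifold h1 k)
  have e2 := inner_pieceGrad_sub_nonneg hy (mem_piece_of_mem_activeManifold hp k)
    (mem_piece_of_mem_activeManifold h2 k)
  rw [add_sub_cancel_left, inner_smul_right, inner_sub_left] at e1 e2
  rw [inner_sub_left]
  have e1' := nonneg_of_mul_nonneg_right e1 ht
  have e2' := nonneg_of_mul_nonneg_right (a := t)
    (b := -(inner ℝ (R.pieceGrad k.1 p) w - inner ℝ y w)) (by linarith) ht
  linarith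

lemma convexity_on_segment (hconv : IsProperConvex h) {p q : Vec m} {v r t : ℝ} (hp : h p = v)
    (hq : h q = r) (ht0 : 0 ≤ t) (ht1 : t ≤ 1) :
    h (p + t • (q - p)) ≤ ((v + t * (r - v) : ℝ) : EReal) := by
  have h1 := hconv.convex_epigraph (x := (p, v)) (by simp [hp]) (y := (q, r)) (by simp [hq])
    (sub_nonneg.2 ht1) ht0 (by ring)
  have h2 : (1 - t) • p + t • q = p + t • (q - p) := by module
  have h3 : (1 - t) * v + t * r = v + t * (r - v) := by ring
  simpa [h2, h3, -EReal.coe_add, -EReal.coe_mul, -EReal.coe_sub] using h1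

/-- Nonnegative combinations of active normals lie in the normal cone of the piece at `p`. -/
lemma inner_activeLin_nonpos {k : R.ActivePiece p₀} {μ : EuclideanSpace ℝ (R.ActiveIdx p₀)}
    (hμ : ∀ j, 0 ≤ μ j) {p q : Vec m} (hp : p ∈ R.activeManifold p₀) (hq : q ∈ R.piece k.1) :
    inner ℝ (activeLin k μ) (q - p) ≤ 0 := by
  rw [inner_activeLin_eq_sum]
  refine Finset.sum_nonpos fun j _ => mul_nonpos_of_nonneg_of_nonpos (hμ j) ?_
  have h1 := mem_piece.1 hq j.1
  rw [inner_sub_right, (mem_activeManifold.1 hp).1 j.1 j.2]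
  linarith

/-- On each active piece the residual `y - ∇` is normal, which gives the subgradient inequality near
`p` up to a second-order error; convexity along segments makes it exact and global. -/
lemma mem_subdifferential_of_multiplierSystem (hconv : IsProperConvex h) {U : Set (Vec m)}
    (hU : R.IsAdapted p₀ U) {k₀ : R.ActivePiece p₀} {p y : Vec m} {μ : R.Multiplier p₀}
    (hpU : p ∈ U) (hp : p ∈ R.activeManifold p₀) (hsys : MultiplierSystem k₀ p y μ)
    (hμ : ∀ k j, 0 ≤ μ k j) : y ∈ subdifferential h p := by
  refine ⟨mem_effDomain_of_mem_piece (mem_piece_of_mem_activeManifold hp k₀), fun q => ?_⟩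
  rw [multiplierSystem_iff] at hsys
  have hv := eq_pieceValue (mem_piece_of_mem_activeManifold hp k₀)
  set v := R.pieceValue k₀.1 p with hvdef
  rcases eq_or_ne (h q) ⊤ with htop | htop
  · rw [htop]
    exact le_top
  obtain ⟨r, hr⟩ : ∃ r : ℝ, h q = r := ⟨(h q).toReal, (EReal.coe_toReal htop (hconv.ne_bot q)).symm⟩
  rw [hv, hr]
  suffices 0 ≤ r - v - inner ℝ y (q - p) by
    have : v + inner ℝ y (q - p) ≤ r := by linarith
    exact_mod_cast this
  have := Fintype.ofFinite (R.ActivePiece p₀)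
  -- The piece containing `p + t (q - p)` may vary with `t`, so `C` bounds the quadratic terms of
  -- all active pieces at once.
  let C : ℝ := ∑ k : R.ActivePiece p₀,
    |1 / 2 * inner ℝ (q - p) (Matrix.toEuclideanLin (R.Q k.1) (q - p))|
  refine nonneg_of_eventually_mul_add_sq (b := C) ?_
  have hcont : Continuous fun t : ℝ => p + t • (q - p) := by fun_prop
  have hU' : ∀ᶠ t in 𝓝[>] (0 : ℝ), p + t • (q - p) ∈ U :=
    (hcont.tendsto 0).mono_left nhdsWithin_le_nhds |>.eventually
      (hU.isOpen.mem_nhds (by simpa using hpU))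
  filter_upwards [Ioo_mem_nhdsGT (zero_lt_one (α := ℝ)), hU'] with t ht htU
  have h1 := convexity_on_segment hconv hv hr ht.1.le ht.2.le
  obtain ⟨k, hk⟩ := hU.cover _ htU (h1.trans_lt (EReal.coe_lt_top _))
  have hvk : v = R.pieceValue k.1 p := by
    have h3 := eq_pieceValue (mem_piece_of_mem_activeManifold hp k)
    rw [hv] at h3
    exact_mod_cast h3
  rw [eq_pieceValue hk] at h1
  have h2 : R.pieceValue k.1 (p + t • (q - p)) ≤ v + t * (r - v) := by exact_mod_cast h1
  rw [pieceValue_add_smul, ← hvk] at h2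
  have h3 := inner_activeLin_nonpos (hμ k) hp hk
  rw [add_sub_cancel_left, inner_smul_right] at h3
  have h4 : inner ℝ y (q - p) =
      inner ℝ (R.pieceGrad k.1 p) (q - p) + inner ℝ (activeLin k (μ k)) (q - p) := by
    rw [← inner_add_left, ← hsys k]
  have h5 : |1 / 2 * inner ℝ (q - p) (Matrix.toEuclideanLin (R.Q k.1) (q - p))| ≤ C :=
    Finset.single_le_sum (f := fun k : R.ActivePiece p₀ =>
      |1 / 2 * inner ℝ (q - p) (Matrix.toEuclideanLin (R.Q k.1) (q - p))|)
      (fun _ _ => abs_nonneg _) (Finset.mem_univ k)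
  have h6 := mul_le_mul_of_nonneg_left ((neg_le_abs _).trans h5) (sq_nonneg t)
  rw [h4]
  linarith

lemma eventually_pos_multiplierOf {k₀ : R.ActivePiece p₀} (hA : Nondegenerate k₀) {p y : Vec m}
    {μ : R.Multiplier p₀} (hsys : MultiplierSystem k₀ p y μ) (hμ : ∀ k j, 0 < μ k j) :
    ∀ᶠ y' in 𝓝 y, ∀ k j, 0 < multiplierOf k₀ p y' k j := by
  have hcont : Continuous fun y' => multiplierOf k₀ p y' :=
    continuous_multiplierOf k₀ continuous_const continuous_id
  have h1 : multiplierOf k₀ p y ∈ {μ : R.Multiplier p₀ | ∀ k j, 0 < μ k j} := by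
    rw [eq_multiplierOf hA hsys]
    exact hμ
  exact hcont.continuousAt (isOpen_pos_multiplier.mem_nhds h1)

/-- The affine span of the subdifferential lies in `y + Ran A`. Nearby points of that affine space
keep positive multipliers, hence are subgradients. -/
lemma mem_intrinsicInterior_subdifferential (hconv : IsProperConvex h) {U : Set (Vec m)}
    (hU : R.IsAdapted p₀ U) {k₀ : R.ActivePiece p₀} (hA : Nondegenerate k₀) {p y : Vec m}
    {μ : R.Multiplier p₀} (hpU : p ∈ U) (hp : p ∈ R.activeManifold p₀)
    (hsys : MultiplierSystem k₀ p y μ) (hμ : ∀ k j, 0 < μ k j) :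
    y ∈ intrinsicInterior ℝ (subdifferential h p) := by
  have hy := mem_subdifferential_of_multiplierSystem hconv hU hpU hp hsys fun k j => (hμ k j).le
  refine mem_intrinsicInterior_iff_eventually.2 ⟨subset_affineSpan ℝ _ hy, ?_⟩
  have hpos := eventually_pos_multiplierOf hA hsys hμ
  filter_upwards [hpos] with y' hy' hspan
  have hle : affineSpan ℝ (subdifferential h p) ≤
      AffineSubspace.mk' y (LinearMap.range (activeLin k₀)) := by
    refine affineSpan_le.2 fun z hz => ?_
    rw [SetLike.mem_coe, AffineSubspace.mem_mk', vsub_eq_sub]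
    have := Submodule.sub_mem _ (sub_pieceGrad_mem_range k₀ k₀ hp hz)
      (sub_pieceGrad_mem_range k₀ k₀ hp hy)
    rwa [sub_sub_sub_cancel_right] at this
  have hr := hle hspan
  rw [AffineSubspace.mem_mk', vsub_eq_sub] at hr
  refine mem_subdifferential_of_multiplierSystem hconv hU hpU hp
    (multiplierSystem_multiplierOf hA fun k => ?_) fun k j => (hy' k j).le
  have := Submodule.add_mem _ hr (sub_pieceGrad_mem_range k₀ k hp hy)
  rwa [sub_add_sub_cancel] at this

/-- A subgradient with a positive multiplier family forces the active constraints to be tight. -/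
lemma mem_activeManifold_of_pos_multiplier {U : Set (Vec m)} (hU : R.IsAdapted p₀ U)
    {k₀ : R.ActivePiece p₀} {p y : Vec m} {μ : R.Multiplier p₀} (hpU : p ∈ U)
    (hy : y ∈ subdifferential h p) (hsys : MultiplierSystem k₀ p y μ) (hμ : ∀ k j, 0 < μ k j) :
    p ∈ R.activeManifold p₀ := by
  obtain ⟨k, hk⟩ := hU.cover p hpU hy.1
  rw [multiplierSystem_iff] at hsys
  refine hU.mem_activeManifold hpU fun j => ?_
  -- Test the subgradient in the direction of `p₀`, which lies in the same piece: a sum of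
  -- nonnegative products `μ_j` times slack is then at most zero, so every slack vanishes.
  have h1 := inner_pieceGrad_sub_nonneg hy hk k.2
  have h2 : R.pieceGrad k.1 p - y = - activeLin k (μ k) := by
    conv_lhs => rw [hsys k]
    abel
  rw [h2, inner_neg_left, inner_activeLin_eq_sum] at h1
  have hnn : ∀ j ∈ (Finset.univ : Finset (R.ActiveIdx p₀)),
      0 ≤ μ k j * (R.ω k.1 j.1 * inner ℝ (R.a j.1) (p₀ - p)) := fun j _ => by
    refine mul_nonneg (hμ k j).le ?_
    have h3 := mem_piece.1 hk j.1
    rw [inner_sub_right, j.2]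
    linarith
  have h3 := (Finset.sum_eq_zero_iff_of_nonneg hnn).1
    (le_antisymm (by linarith) (Finset.sum_nonneg hnn)) j (Finset.mem_univ j)
  have h4 := (mul_eq_zero.1 h3).resolve_left (hμ k j).ne'
  have h5 : R.ω k.1 j.1 ≠ 0 := fun h0 => by
    have := ω_mul_self k.1 j.1
    simp [h0] at this
  have h6 := (mul_eq_zero.1 h4).resolve_left h5
  rw [inner_sub_right, j.2] at h6
  linarith

lemma self_mem_activeManifold (p₀ : Vec m) : p₀ ∈ R.activeManifold p₀ := by
  obtain ⟨U, hU⟩ := exists_isAdapted R p₀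
  exact hU.mem_activeManifold hU.mem fun j => j.2

/-- Along directions tangent to the active manifold, the second directional derivative is given by
each of the active quadratic pieces. -/
lemma hasSecondDirDeriv_eq {k₀ : R.ActivePiece p₀} {w : Vec m} {L : EReal}
    (hw : activeLinT k₀ w = 0) (hL : HasSecondDirDeriv h p₀ w L) (k : R.ActivePiece p₀) :
    L = ((inner ℝ w (Matrix.toEuclideanLin (R.Q k.1) w) : ℝ) : EReal) := by
  obtain ⟨D, hD, hL⟩ := hL
  have hev : ∀ᶠ t in 𝓝[>] (0 : ℝ), p₀ + t • w ∈ R.piece k.1 := by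
    filter_upwards [(eventually_add_smul_mem_activeManifold (self_mem_activeManifold p₀)
      hw).filter_mono nhdsWithin_le_nhds] with t ht
    exact mem_piece_of_mem_activeManifold ht k
  set g : ℝ := inner ℝ (R.pieceGrad k.1 p₀) w
  set s : ℝ := inner ℝ w (Matrix.toEuclideanLin (R.Q k.1) w)
  -- The first-order slope is only given as some limit `D`; it must be identified before the second
  -- quotient can be evaluated.
  have hDg : D = g := by
    have h1 : Tendsto (fun t : ℝ => ((g + t * (1 / 2 * s) : ℝ) : EReal)) (𝓝[>] 0)
        (𝓝 (g : EReal)) := by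
      refine (continuous_coe_real_ereal.tendsto g).comp ?_
      have : Continuous fun t : ℝ => g + t * (1 / 2 * s) := by fun_prop
      simpa using (this.tendsto 0).mono_left nhdsWithin_le_nhds
    have h2 := tendsto_nhds_unique (hD.congr' (f₂ := fun t : ℝ =>
      ((g + t * (1 / 2 * s) : ℝ) : EReal)) ?_) h1
    · exact_mod_cast h2
    · filter_upwards [hev, self_mem_nhdsWithin] with t ht ht0
      have ht0' : t ≠ 0 := ne_of_gt ht0
      rw [eq_pieceValue ht, eq_pieceValue k.2, pieceValue_add_smul, ← EReal.coe_sub,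
        ← EReal.coe_div]
      congr 1
      field_simp
      ring
  refine tendsto_nhds_unique hL (tendsto_const_nhds.congr' ?_)
  filter_upwards [hev, self_mem_nhdsWithin] with t ht ht0
  have ht0' : t ≠ 0 := ne_of_gt ht0
  rw [eq_pieceValue ht, eq_pieceValue k.2, pieceValue_add_smul, ← EReal.coe_sub, ← EReal.coe_sub,
    ← EReal.coe_div, hDg]
  congr 1
  field_simp
  ring

end RWRepresentation

end

end PLQComposite

namespace PLQComposite

noncomputable section

open RWRepresentation

section Newton

variable {n m : ℕ} {h : Vec m → EReal} {R : RWRepresentation h} {p₀ : Vec m} {c : Vec n → Vec m}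

/-! ### The Newton operator -/

/-- The linear operator of the Newton system on the active manifold at `(x, y)`:
`(d, η, v) ↦ (∇²(yc)(x) d + ∇c(x)ᵀ η, Aᵀ ∇c(x) d, η - Q ∇c(x) d - A v)`. -/
def newtonOp (c : Vec n → Vec m) (k₀ : R.ActivePiece p₀) (w : Vec n × Vec m) :
    (Vec n × Vec m × EuclideanSpace ℝ (R.ActiveIdx p₀)) →L[ℝ]
      (Vec n × EuclideanSpace ℝ (R.ActiveIdx p₀) × Vec m) :=
  LinearMap.toContinuousLinearMap
    { toFun := fun v => (hessYC c w.2 w.1 v.1 + jacT c w.1 v.2.1,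
        activeLinT k₀ (fderiv ℝ c w.1 v.1),
        v.2.1 - Matrix.toEuclideanLin (R.Q k₀.1) (fderiv ℝ c w.1 v.1) - activeLin k₀ v.2.2)
      map_add' := fun u v => by
        simp only [jacT, Prod.fst_add, Prod.snd_add, map_add, Prod.mk_add_mk, Prod.mk.injEq]
        refine ⟨by abel, trivial, by abel⟩
      map_smul' := fun r v => by
        simp only [jacT, Prod.smul_fst, Prod.smul_snd, map_smul, Prod.smul_mk, smul_sub, smul_add,
          RingHom.id_apply] }

lemma newtonOp_apply (k₀ : R.ActivePiece p₀) (w : Vec n × Vec m)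
    (v : Vec n × Vec m × EuclideanSpace ℝ (R.ActiveIdx p₀)) :
    newtonOp c k₀ w v = (hessYC c w.2 w.1 v.1 + jacT c w.1 v.2.1,
        activeLinT k₀ (fderiv ℝ c w.1 v.1),
        v.2.1 - Matrix.toEuclideanLin (R.Q k₀.1) (fderiv ℝ c w.1 v.1) - activeLin k₀ v.2.2) :=
  rfl

lemma continuous_newtonOp (hc : ContDiff ℝ 3 c) (k₀ : R.ActivePiece p₀) :
    Continuous (newtonOp c k₀ : Vec n × Vec m → _) := by
  refine continuous_clm_apply.2 fun v => ?_
  simp only [newtonOp_apply]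
  have h1 : Continuous fun w : Vec n × Vec m => fderiv ℝ c w.1 v.1 :=
    ((hc.continuous_fderiv (by norm_num)).comp continuous_fst).clm_apply continuous_const
  have h2 : Continuous fun w : Vec n × Vec m => jacT c w.1 v.2.1 :=
    (contDiff_jacT hc v.2.1).continuous.comp continuous_fst
  have h3 : Continuous fun w : Vec n × Vec m => hessYC c w.2 w.1 v.1 :=
    (continuous_hessYC hc).clm_apply continuous_const
  exact (h3.add h2).prodMk (((activeLinT k₀).continuous_of_finiteDimensional.comp h1).prodMk
    ((continuous_const.sub
      ((LinearMap.continuous_of_finiteDimensional _).comp h1)).sub continuous_const))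

/-- Pairing the first equation with `d` removes the multiplier term because `Aᵀ ∇c d = 0`; curvature
gives `d = 0`, then transversality and nondegeneracy give `l = 0`. -/
lemma newtonOp_injective {k₀ : R.ActivePiece p₀} (hA : Nondegenerate k₀) {w : Vec n × Vec m}
    (hw : CurvatureTransversality c k₀ w.1 w.2)
    (v : Vec n × Vec m × EuclideanSpace ℝ (R.ActiveIdx p₀)) (hv : newtonOp c k₀ w v = 0) :
    v = 0 := by
  obtain ⟨d, η, l⟩ := v
  simp only [newtonOp_apply, Prod.mk_eq_zero] at hv
  obtain ⟨h1, h2, h3⟩ := hv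
  have h4 : η = Matrix.toEuclideanLin (R.Q k₀.1) (fderiv ℝ c w.1 d) + activeLin k₀ l := by
    rw [← sub_eq_zero, ← h3]
    abel
  have hd : d = 0 := by
    by_contra hd
    have h5 := hw.curvature k₀ d hd h2
    have h6 : inner ℝ (hessYC c w.2 w.1 d + jacT c w.1 η) d = 0 := by rw [h1, inner_zero_left]
    rw [inner_add_left, inner_jacT, h4, inner_add_left, inner_activeLin, h2, inner_zero_right,
      add_zero, real_inner_comm, real_inner_comm (fderiv ℝ c w.1 d)] at h6
    linarith
  subst hd
  simp only [map_zero, zero_add] at h1 h4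
  rw [h4] at h1
  have h5 := hw.transversal l h1
  have h6 := hA l h5
  subst h6
  simp [h4]

lemma newtonOp_surjective {k₀ : R.ActivePiece p₀} {w : Vec n × Vec m}
    (hw : ∀ v, newtonOp c k₀ w v = 0 → v = 0) : Function.Surjective (newtonOp c k₀ w) := by
  have hd : Module.finrank ℝ (Vec n × Vec m × EuclideanSpace ℝ (R.ActiveIdx p₀)) =
      Module.finrank ℝ (Vec n × EuclideanSpace ℝ (R.ActiveIdx p₀) × Vec m) := by
    simp only [Module.finrank_prod]
    ring
  exact (LinearMap.injective_iff_surjective_of_finrank_eq_finrank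
    (f := (newtonOp c k₀ w : _ →ₗ[ℝ] _)) hd).1 (LinearMap.ker_eq_bot.1
      (LinearMap.ker_eq_bot'.2 hw))

/-! ### Curvature and transversality -/

lemma continuous_linPoint (hc : ContDiff ℝ 3 c) {X : Type*} [TopologicalSpace X]
    {f g : X → Vec n} (hf : Continuous f) (hg : Continuous g) :
    Continuous fun u => linPoint c (f u) (g u) :=
  (hc.continuous.comp hf).add
    (((hc.continuous_fderiv (by norm_num)).comp hf).clm_apply (hg.sub hf))

lemma StrictlyCritical.jacT_eq_zero {xbar : Vec n} {ybar : Vec m}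
    (hSC : StrictlyCritical h c xbar ybar) : jacT c xbar ybar = 0 := by
  have : ybar ∈ {v | jacT c xbar v = 0} ∩ intrinsicInterior ℝ (subdifferential h (c xbar)) := by
    rw [hSC]
    rfl
  exact this.1

/-- For transversality, small `t > 0` keeps the multipliers of `ybar + t A v` positive, so this
point satisfies strict criticality's conditions and must equal `ybar`. -/
lemma curvatureTransversality_of_secondOrderSufficient (hconv : IsProperConvex h) {xbar : Vec n}
    {ybar : Vec m} {k₀ : R.ActivePiece (c xbar)} (hA : Nondegenerate k₀)
    (hSC : StrictlyCritical h c xbar ybar) {μbar : R.Multiplier (c xbar)}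
    (hμbar : MultiplierSystem k₀ (c xbar) ybar μbar) (hpos : ∀ k j, 0 < μbar k j)
    (hSOSC : SecondOrderSufficient c k₀ xbar ybar) :
    CurvatureTransversality c k₀ xbar ybar := by
  refine ⟨fun k d hd hAd => ?_, fun v hv => ?_⟩
  · obtain ⟨L, hL, hL0⟩ := hSOSC d hd hAd
    rw [hasSecondDirDeriv_eq hAd hL k, ← EReal.coe_add] at hL0
    exact_mod_cast hL0
  · obtain ⟨U, hU⟩ := exists_isAdapted R (c xbar)
    have hpM := self_mem_activeManifold (R := R) (c xbar)
    have hcrit := hSC.jacT_eq_zero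
    have hcont : Continuous fun t : ℝ => ybar + t • activeLin k₀ v := by fun_prop
    have hev := (hcont.tendsto' 0 ybar (by simp)).eventually
      (eventually_pos_multiplierOf hA hμbar hpos)
    obtain ⟨t, ht, ht0⟩ := ((hev.filter_mono nhdsWithin_le_nhds).and
      (self_mem_nhdsWithin (s := Ioi (0 : ℝ)))).exists
    have hri := mem_intrinsicInterior_subdifferential hconv hU hA hU.mem hpM
      (multiplierSystem_multiplierOf hA (q := c xbar) (y := ybar + t • activeLin k₀ v)
        fun k => ?_) ht
    · have hmem : ybar + t • activeLin k₀ v ∈ ({ybar} : Set (Vec m)) := by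
        rw [← hSC]
        refine ⟨?_, hri⟩
        rw [jacT] at hcrit hv
        simp only [mem_ofPred_eq, jacT, map_add, map_smul, hcrit]
        rw [hv, smul_zero, add_zero]
      have h1 : t • activeLin k₀ v = 0 := by simpa using hmem
      exact (smul_eq_zero.1 h1).resolve_left (ne_of_gt ht0)
    · have h1 : ybar - R.pieceGrad k.1 (c xbar) ∈ LinearMap.range (activeLin k₀) :=
        sub_pieceGrad_mem_range k₀ k hpM (mem_subdifferential_of_multiplierSystem hconv hU hU.mem
          hpM hμbar fun k j => (hpos k j).le)
      have h2 := Submodule.add_mem _ h1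
        (Submodule.smul_mem _ t (LinearMap.mem_range_self (activeLin k₀) v))
      rwa [sub_add_eq_add_sub] at h2

lemma continuous_modelQuadratic (hc : ContDiff ℝ 3 c) (k : Fin R.numPieces) :
    Continuous fun z : (Vec n × Vec m) × Vec n =>
      inner ℝ (fderiv ℝ c z.1.1 z.2) (Matrix.toEuclideanLin (R.Q k) (fderiv ℝ c z.1.1 z.2)) +
        inner ℝ z.2 (hessYC c z.1.2 z.1.1 z.2) := by
  have h1 : Continuous fun z : (Vec n × Vec m) × Vec n => fderiv ℝ c z.1.1 z.2 :=
    ((hc.continuous_fderiv (by norm_num)).comp (continuous_fst.comp continuous_fst)).clm_apply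
      continuous_snd
  have h2 : Continuous fun z : (Vec n × Vec m) × Vec n => hessYC c z.1.2 z.1.1 z.2 :=
    ((continuous_hessYC hc).comp continuous_fst).clm_apply continuous_snd
  exact (h1.inner ((LinearMap.continuous_of_finiteDimensional _).comp h1)).add
    (continuous_snd.inner h2)

lemma eventually_curvatureTransversality (hc : ContDiff ℝ 3 c) {k₀ : R.ActivePiece p₀}
    (hA : Nondegenerate k₀) {w₀ : Vec n × Vec m} (hw₀ : CurvatureTransversality c k₀ w₀.1 w₀.2) :
    ∀ᶠ w in 𝓝 w₀, CurvatureTransversality c k₀ w.1 w.2 := by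
  have h1 : ∀ᶠ w in 𝓝 w₀, ∀ k : R.ActivePiece p₀, ∀ d : Vec n, d ≠ 0 →
      activeLinT k₀ (fderiv ℝ c w.1 d) = 0 →
      (0 : ℝ) < inner ℝ (fderiv ℝ c w.1 d) (Matrix.toEuclideanLin (R.Q k.1) (fderiv ℝ c w.1 d)) +
        inner ℝ d (hessYC c w.2 w.1 d) := by
    refine eventually_all.2 fun k => ?_
    refine eventually_pos_on_ker (q := fun (w : Vec n × Vec m) d =>
      inner ℝ (fderiv ℝ c w.1 d) (Matrix.toEuclideanLin (R.Q k.1) (fderiv ℝ c w.1 d)) +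
        inner ℝ d (hessYC c w.2 w.1 d)) (continuous_modelQuadratic hc k.1)
      (L := fun w => (activeLinT k₀).toContinuousLinearMap ∘L fderiv ℝ c w.1)
      (continuous_const.clm_comp ((hc.continuous_fderiv (by norm_num)).comp continuous_fst))
      (fun w t d => ?_) (hw₀.curvature k)
    simp only [map_smul, inner_smul_left, inner_smul_right, conj_trivial]
    ring
  obtain ⟨κ, hκ, h2⟩ := eventually_le_norm_apply (continuous_newtonOp hc k₀).continuousAt
    (newtonOp_injective hA hw₀)
  filter_upwards [h1, h2] with w hw1 hw2
  refine ⟨hw1, fun v hv => ?_⟩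
  -- A failure of transversality would produce this kernel vector of the Newton operator, which is
  -- bounded below near `w₀`.
  have h3 := hw2 (0, activeLin k₀ v, v)
  have h4 : newtonOp c k₀ w (0, activeLin k₀ v, v) = 0 := by
    simp [newtonOp_apply, hv]
  rw [h4, norm_zero] at h3
  have h5 : ((0, activeLin k₀ v, v) : Vec n × Vec m × EuclideanSpace ℝ (R.ActiveIdx p₀)) = 0 :=
    norm_le_zero_iff.1 (nonpos_of_mul_nonpos_right h3 hκ)
  simp only [Prod.mk_eq_zero] at h5
  exact h5.2.1

/-! ### Newton steps on the active manifold -/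

/-- The optimality system of the Newton subproblem restricted to the active manifold. -/
structure IsActiveStep (c : Vec n → Vec m) (k₀ : R.ActivePiece p₀) (w w' : Vec n × Vec m)
    (l : EuclideanSpace ℝ (R.ActiveIdx p₀)) : Prop where
  stationary : hessYC c w.2 w.1 (w'.1 - w.1) + jacT c w.1 w'.2 = 0
  tangent : activeLinT k₀ (linPoint c w.1 w'.1 - p₀) = 0
  dual : w'.2 = R.pieceGrad k₀.1 (linPoint c w.1 w'.1) + activeLin k₀ l

lemma exists_isActiveStep {k₀ : R.ActivePiece p₀} {w : Vec n × Vec m}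
    (hw : ∀ v, newtonOp c k₀ w v = 0 → v = 0) : ∃ w' l, IsActiveStep c k₀ w w' l := by
  -- The right-hand side collects the constant terms left after writing the linearized point as `c x
  -- + ∇c(x) d`.
  obtain ⟨⟨d, η, l⟩, hv⟩ := newtonOp_surjective hw
    (0, activeLinT k₀ (p₀ - c w.1), R.pieceGrad k₀.1 (c w.1))
  simp only [newtonOp_apply, Prod.mk.injEq] at hv
  obtain ⟨h1, h2, h3⟩ := hv
  have hlin : linPoint c w.1 (w.1 + d) = c w.1 + fderiv ℝ c w.1 d := by simp [linPoint]
  refine ⟨(w.1 + d, η), l, by simpa using h1, ?_, ?_⟩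
  · rw [hlin, add_sub_right_comm, map_add, h2, ← map_add]
    simp
  · rw [hlin, pieceGrad, map_add, ← sub_eq_zero]
    rw [pieceGrad, ← sub_eq_zero] at h3
    rw [← h3]
    simp only
    abel

lemma IsActiveStep.unique {k₀ : R.ActivePiece p₀} {w w₁ w₂ : Vec n × Vec m}
    (hw : ∀ v, newtonOp c k₀ w v = 0 → v = 0) {l₁ l₂ : EuclideanSpace ℝ (R.ActiveIdx p₀)}
    (h₁ : IsActiveStep c k₀ w w₁ l₁) (h₂ : IsActiveStep c k₀ w w₂ l₂) : w₁ = w₂ := by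
  have hlin : linPoint c w.1 w₁.1 - linPoint c w.1 w₂.1 = fderiv ℝ c w.1 (w₁.1 - w₂.1) := by
    simp only [linPoint, map_sub]
    abel
  have key := hw (w₁.1 - w₂.1, w₁.2 - w₂.2, l₁ - l₂) (by
    simp only [newtonOp_apply, Prod.mk_eq_zero]
    refine ⟨?_, ?_, ?_⟩
    · have e := congrArg₂ (· - ·) h₁.stationary h₂.stationary
      simp only [jacT, sub_zero, map_sub] at e ⊢
      rw [← e]
      abel
    · have e := congrArg₂ (· - ·) h₁.tangent h₂.tangent
      simp only [sub_zero] at e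
      rw [← map_sub, sub_sub_sub_cancel_right, hlin] at e
      exact e
    · rw [h₁.dual, h₂.dual, ← hlin]
      simp only [pieceGrad, map_sub]
      abel)
  simp only [Prod.mk_eq_zero, sub_eq_zero] at key
  exact Prod.ext key.1 key.2.1

/-- Quadratic estimate for a Newton step on the active manifold. -/
lemma eventually_isActiveStep_norm_le (hc : ContDiff ℝ 3 c) {xbar : Vec n} {ybar : Vec m}
    {k₀ : R.ActivePiece (c xbar)} (hA : Nondegenerate k₀)
    (hCT : CurvatureTransversality c k₀ xbar ybar) (hcrit : jacT c xbar ybar = 0)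
    {lbar : EuclideanSpace ℝ (R.ActiveIdx (c xbar))}
    (hbar : ybar = R.pieceGrad k₀.1 (c xbar) + activeLin k₀ lbar) :
    ∃ γ : ℝ, 0 < γ ∧ ∀ᶠ w in 𝓝 (xbar, ybar), ∀ w' l, IsActiveStep c k₀ w w' l →
      ‖w' - (xbar, ybar)‖ ≤ γ * ‖w - (xbar, ybar)‖ ^ 2 := by
  obtain ⟨κ, hκ, h1⟩ := eventually_le_norm_apply (continuous_newtonOp hc k₀).continuousAt
    (newtonOp_injective (w := (xbar, ybar)) hA hCT)
  obtain ⟨K₁, h2⟩ := eventually_taylor_le (contDiff_jacT hc ybar) xbar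
  obtain ⟨K₂, h3⟩ := eventually_taylor_le (hc.of_le (by norm_num)) xbar
  obtain ⟨K₃, h4⟩ := eventually_norm_hessYC_le hc xbar
  let T := (activeLinT k₀).toContinuousLinearMap
  let S := (Matrix.toEuclideanLin (R.Q k₀.1)).toContinuousLinearMap
  let C : ℝ := |K₁| + |K₃| + ‖T‖ * |K₂| + ‖S‖ * |K₂|
  have hC : 0 ≤ C := by positivity
  -- The added `1` only secures positivity of the constant.
  refine ⟨κ⁻¹ * C + 1, by positivity, ?_⟩
  have hfst : Tendsto (Prod.fst : Vec n × Vec m → Vec n) (𝓝 (xbar, ybar)) (𝓝 xbar) :=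
    continuous_fst.tendsto _
  filter_upwards [h1, hfst.eventually h2, hfst.eventually h3, hfst.eventually h4]
    with w hw1 hw2 hw3 hw4 w' l hstep
  obtain ⟨x, y⟩ := w
  obtain ⟨x', y'⟩ := w'
  set e := ‖(x, y) - (xbar, ybar)‖
  have hx : ‖x - xbar‖ ≤ e := norm_fst_le ((x, y) - (xbar, ybar))
  have hy : ‖y - ybar‖ ≤ e := norm_snd_le ((x, y) - (xbar, ybar))
  have he : 0 ≤ e := norm_nonneg _
  simp only at hw2 hw3 hw4
  set r := c xbar - c x - fderiv ℝ c x (xbar - x) with hr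
  have hr' : ‖r‖ ≤ |K₂| * e ^ 2 :=
    hw3.trans (mul_le_mul (le_abs_self _) (by gcongr) (by positivity) (abs_nonneg _))
  have hJ : fderiv ℝ c x (x' - xbar) = linPoint c x x' - c xbar + r := by
    simp only [linPoint, hr, map_sub]
    abel
  rw [fderiv_jacT hc, hcrit, zero_sub] at hw2
  have hop := hw1 (x' - xbar, y' - ybar, l - lbar)
  -- The operator applied to the new error leaves only second-order residuals: Taylor remainders of
  -- `∇c(·)ᵀ ybar` and of `c`, and a product of the errors in `y` and `x`.
  have hval : newtonOp c k₀ (x, y) (x' - xbar, y' - ybar, l - lbar) =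
      ((-jacT c x ybar - hessYC c ybar x (xbar - x)) + hessYC c (y - ybar) x (x - xbar),
        T r, -S r) := by
    rw [newtonOp_apply]
    refine Prod.ext ?_ (Prod.ext ?_ ?_)
    · have e1 := hstep.stationary
      simp only [jacT, map_sub, hessYC_sub hc] at e1 ⊢
      rw [← sub_eq_zero, ← e1]
      abel
    · simp only
      rw [hJ, map_add, hstep.tangent, zero_add]
      rfl
    · have e1 := hstep.dual
      simp only at e1 ⊢
      rw [hJ, e1]
      conv_lhs => rw [hbar]
      simp only [pieceGrad, map_add, map_sub]
      change _ = -(Matrix.toEuclideanLin (R.Q k₀.1) r)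
      abel
  have hb : ‖newtonOp c k₀ (x, y) (x' - xbar, y' - ybar, l - lbar)‖ ≤ C * e ^ 2 := by
    rw [hval, norm_prod_le_iff, norm_prod_le_iff]
    have e2 : 0 ≤ e ^ 2 := by positivity
    have b1 : ‖T r‖ ≤ ‖T‖ * |K₂| * e ^ 2 := by
      rw [mul_assoc]
      exact (T.le_opNorm r).trans (by gcongr)
    have b2 : ‖S r‖ ≤ ‖S‖ * |K₂| * e ^ 2 := by
      rw [mul_assoc]
      exact (S.le_opNorm r).trans (by gcongr)
    have b3 : ‖(-jacT c x ybar - hessYC c ybar x (xbar - x)) +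
        hessYC c (y - ybar) x (x - xbar)‖ ≤ (|K₁| + |K₃|) * e ^ 2 := by
      refine (norm_add_le _ _).trans ?_
      rw [add_mul]
      refine add_le_add (hw2.trans ?_) ((hw4 _ _).trans ?_)
      · exact mul_le_mul (le_abs_self _) (by gcongr) (by positivity) (abs_nonneg _)
      · rw [mul_assoc, sq]
        exact mul_le_mul (le_abs_self _) (by gcongr) (by positivity) (abs_nonneg _)
    have n1 : 0 ≤ (|K₁| + |K₃|) * e ^ 2 := by positivity
    have n2 : 0 ≤ ‖T‖ * |K₂| * e ^ 2 := by positivity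
    have n3 : 0 ≤ ‖S‖ * |K₂| * e ^ 2 := by positivity
    have hCe : C * e ^ 2 = (|K₁| + |K₃|) * e ^ 2 + ‖T‖ * |K₂| * e ^ 2 + ‖S‖ * |K₂| * e ^ 2 := by
      simp only [C]
      ring
    simp only [norm_neg]
    refine ⟨?_, ?_, ?_⟩ <;> linarith
  have hle : ‖(x', y') - (xbar, ybar)‖ ≤ ‖(x' - xbar, y' - ybar, l - lbar)‖ := by
    refine norm_prod_le_iff.2 ⟨norm_fst_le (x' - xbar, y' - ybar, l - lbar), ?_⟩
    exact (norm_fst_le (y' - ybar, l - lbar)).trans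
      (norm_snd_le (x' - xbar, y' - ybar, l - lbar))
  have hfin : κ * ‖(x', y') - (xbar, ybar)‖ ≤ C * e ^ 2 :=
    (mul_le_mul_of_nonneg_left hle hκ.le).trans (hop.trans hb)
  calc ‖(x', y') - (xbar, ybar)‖ ≤ κ⁻¹ * (C * e ^ 2) := by
        rwa [le_inv_mul_iff₀ hκ]
    _ ≤ (κ⁻¹ * C + 1) * e ^ 2 := by nlinarith [sq_nonneg e]

/-! ### Strong minimality of the Newton step -/

lemma isStrongLocalMin_modelFn (hc : ContDiff ℝ 3 c) {U : Set (Vec m)} (hU : R.IsAdapted p₀ U)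
    {k₀ : R.ActivePiece p₀} {x d : Vec n} {y y' : Vec m} {μ : R.Multiplier p₀}
    (hCT : CurvatureTransversality c k₀ x y) (hpU : c x + fderiv ℝ c x d ∈ U)
    (hp : c x + fderiv ℝ c x d ∈ R.activeManifold p₀)
    (hsys : MultiplierSystem k₀ (c x + fderiv ℝ c x d) y' μ) (hμ : ∀ k j, 0 < μ k j)
    (hstat : hessYC c y x d + jacT c x y' = 0) :
    IsStrongLocalMin (modelFn h c x y) d := by
  rw [multiplierSystem_iff] at hsys
  set p := c x + fderiv ℝ c x d with hpdef
  have hval : ∀ k : R.ActivePiece p₀, modelFn h c x y d =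
      ((R.pieceValue k.1 p + 1 / 2 * inner ℝ d (hessYC c y x d) : ℝ) : EReal) := fun k => by
    rw [modelFn, ← hpdef, eq_pieceValue (mem_piece_of_mem_activeManifold hp k), ← EReal.coe_add]
  have hF : ∀ k : R.ActivePiece p₀, ∃ ρ : ℝ, 0 ≤ ρ ∧ ∃ σ : ℝ, 0 < σ ∧ ∀ v, σ * ‖v‖ ^ 2 ≤
      (inner ℝ (fderiv ℝ c x v) (Matrix.toEuclideanLin (R.Q k.1) (fderiv ℝ c x v)) +
        inner ℝ v (hessYC c y x v)) + ρ * ‖activeLinT k (fderiv ℝ c x v)‖ ^ 2 := fun k => by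
    refine exists_le_add_mul_norm_sq
      ((continuous_modelQuadratic hc k.1).comp (Continuous.prodMk_right (x, y)))
      (fun t v => ?_) ((activeLinT k).toContinuousLinearMap ∘L fderiv ℝ c x) fun v hv hv0 => ?_
    · simp only [Function.comp, map_smul, inner_smul_left, inner_smul_right, conj_trivial]
      ring
    · refine hCT.curvature k v hv ((activeLinT_eq_zero_iff k₀ _).2 ?_)
      exact (activeLinT_eq_zero_iff k _).1 hv0
  choose ρ hρ σ hσ hfins using hF
  have : Nonempty (R.ActivePiece p₀) := ⟨k₀⟩
  obtain ⟨k₁, hk₁⟩ := Finite.exists_min σ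
  have hcont : Continuous fun e => c x + fderiv ℝ c x e := by fun_prop
  have ev1 : ∀ᶠ e in 𝓝 d, c x + fderiv ℝ c x e ∈ U :=
    (hcont.tendsto d).eventually (hU.isOpen.mem_nhds hpU)
  -- With slack `s_j ≤ 0`, the bound `-(ρ/2) s_j < μ_j` gives `μ_j s_j ≤ -(ρ/2) s_j²`: the linear
  -- gain from positive multipliers pays for the Finsler penalty.
  have ev2 : ∀ᶠ e in 𝓝 d, ∀ k : R.ActivePiece p₀, ∀ j : R.ActiveIdx p₀,
      -(ρ k / 2 * (R.ω k.1 j.1 * inner ℝ (R.a j.1) (fderiv ℝ c x (e - d)))) < μ k j := by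
    refine eventually_all.2 fun k => eventually_all.2 fun j => ?_
    have h4 : Continuous fun e =>
        -(ρ k / 2 * (R.ω k.1 j.1 * inner ℝ (R.a j.1) (fderiv ℝ c x (e - d)))) := by
      fun_prop
    exact (h4.tendsto d).eventually (gt_mem_nhds (by simpa using hμ k j))
  refine ⟨by rw [hval k₀]; exact EReal.coe_ne_top _, by rw [hval k₀]; exact EReal.coe_ne_bot _, _,
    ev1.and ev2, σ k₁ / 2, half_pos (hσ k₁), ?_⟩
  rintro e ⟨he1, he2⟩
  by_cases htop : h (c x + fderiv ℝ c x e) = ⊤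
  · have h1 : modelFn h c x y e = ⊤ := by rw [modelFn, htop, EReal.top_add_coe]
    rw [h1]
    exact le_top
  obtain ⟨k, hk⟩ := hU.cover _ he1 (lt_top_iff_ne_top.2 htop)
  rw [hval k, modelFn, eq_pieceValue hk, ← EReal.coe_add, ← EReal.coe_add, EReal.coe_le_coe_iff]
  set v := e - d with hv
  have hed : e = d + v := by rw [hv]; abel
  set w := fderiv ℝ c x v with hw
  have hpe : c x + fderiv ℝ c x e = p + w := by
    rw [hed, map_add, hpdef]
    abel
  rw [hpe] at hk ⊢
  have e1 : inner ℝ e (hessYC c y x e) = inner ℝ d (hessYC c y x d) +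
      2 * inner ℝ (hessYC c y x d) v + inner ℝ v (hessYC c y x v) := by
    rw [hed, map_add, inner_add_left, inner_add_right, inner_add_right,
      ← inner_hessYC_comm hc y x d v, real_inner_comm (hessYC c y x d) v]
    ring
  have e2 : inner ℝ (hessYC c y x d) v + inner ℝ y' w = 0 := by
    rw [hw, ← inner_jacT, ← inner_add_left, hstat, inner_zero_left]
  have e3 : inner ℝ y' w = inner ℝ (R.pieceGrad k.1 p) w + inner ℝ (activeLin k (μ k)) w := by
    rw [← inner_add_left, ← hsys k]
  have e4 : inner ℝ (activeLin k (μ k)) w ≤ -(ρ k / 2 * ‖activeLinT k w‖ ^ 2) := by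
    rw [inner_activeLin_eq_sum, EuclideanSpace.norm_sq_eq, Finset.mul_sum, ← Finset.sum_neg_distrib]
    refine Finset.sum_le_sum fun j _ => ?_
    rw [activeLinT_apply, Real.norm_eq_abs, sq_abs]
    have h1 := mem_piece.1 hk j.1
    rw [inner_add_right, (mem_activeManifold.1 hp).1 j.1 j.2] at h1
    have h2 : R.ω k.1 j.1 * inner ℝ (R.a j.1) w ≤ 0 := by linarith
    have h3 := mul_le_mul_of_nonpos_right (he2 k j).le h2
    linarith
  have e5 := hfins k v
  have e6 : σ k₁ * ‖v‖ ^ 2 ≤ σ k * ‖v‖ ^ 2 := by gcongr; exact hk₁ k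
  rw [← hw] at e5
  -- By stationarity the increase of the model is half the curvature form at `v` minus `⟨A_k μ_k,
  -- w⟩`; hence the growth constant `σ/2`.
  rw [pieceValue_add k.1 p w, e1]
  linarith

end Newton

end

end PLQComposite

namespace PLQComposite

noncomputable section

open RWRepresentation

section Iteration

variable {n m : ℕ} {h : Vec m → EReal} {R : RWRepresentation h} {p₀ : Vec m} {c : Vec n → Vec m}

/-! ### Steps with multiplier families -/

/-- A Newton step whose linearized point lies on the active manifold, with its multipliers. -/
structure IsManifoldStep (c : Vec n → Vec m) (k₀ : R.ActivePiece p₀)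
    (u u' : Vec n × Vec m × R.Multiplier p₀) : Prop where
  stationary : hessYC c u.2.1 u.1 (u'.1 - u.1) + jacT c u.1 u'.2.1 = 0
  mem_manifold : linPoint c u.1 u'.1 ∈ R.activeManifold p₀
  multipliers : MultiplierSystem k₀ (linPoint c u.1 u'.1) u'.2.1 u'.2.2

lemma IsManifoldStep.isActiveStep {k₀ : R.ActivePiece p₀} {u u' : Vec n × Vec m × R.Multiplier p₀}
    (hu : IsManifoldStep c k₀ u u') :
    IsActiveStep c k₀ (u.1, u.2.1) (u'.1, u'.2.1) (u'.2.2 k₀) := by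
  refine ⟨hu.stationary, ?_, multiplierSystem_iff.1 hu.multipliers k₀⟩
  rw [activeLinT_eq_zero_iff]
  intro j
  rw [inner_sub_right, (mem_activeManifold.1 hu.mem_manifold).1 j.1 j.2, j.2, sub_self]

lemma IsManifoldStep.unique {k₀ : R.ActivePiece p₀} (hA : Nondegenerate k₀)
    {u u₁ u₂ : Vec n × Vec m × R.Multiplier p₀}
    (hCT : CurvatureTransversality c k₀ u.1 u.2.1) (h₁ : IsManifoldStep c k₀ u u₁)
    (h₂ : IsManifoldStep c k₀ u u₂) : u₁ = u₂ := by
  have key := h₁.isActiveStep.unique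
    (newtonOp_injective (w := (u.1, u.2.1)) hA hCT) h₂.isActiveStep
  obtain ⟨x₁, y₁, μ₁⟩ := u₁
  obtain ⟨x₂, y₂, μ₂⟩ := u₂
  simp only [Prod.mk.injEq] at key
  obtain ⟨rfl, rfl⟩ := key
  have e1 := eq_multiplierOf hA h₁.multipliers
  have e2 := eq_multiplierOf hA h₂.multipliers
  simp only at e1 e2
  rw [← e1, ← e2]

/-- A Newton step on the active tangent plane that lands in an adapted neighborhood is a step on
the active manifold, with the multipliers given by the explicit formula. -/
lemma IsActiveStep.isManifoldStep {k₀ : R.ActivePiece p₀} (hA : Nondegenerate k₀)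
    {U : Set (Vec m)} (hU : R.IsAdapted p₀ U) {w w' : Vec n × Vec m}
    {l : EuclideanSpace ℝ (R.ActiveIdx p₀)} {μ : R.Multiplier p₀} (hs : IsActiveStep c k₀ w w' l)
    (hw' : linPoint c w.1 w'.1 ∈ U) :
    IsManifoldStep c k₀ (w.1, w.2, μ)
      (w'.1, w'.2, multiplierOf k₀ (linPoint c w.1 w'.1) w'.2) := by
  have hM : linPoint c w.1 w'.1 ∈ R.activeManifold p₀ := by
    refine hU.mem_activeManifold hw' fun j => ?_
    have e1 := (activeLinT_eq_zero_iff k₀ _).1 hs.tangent j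
    rw [inner_sub_right, j.2] at e1
    linarith
  refine ⟨hs.stationary, hM, multiplierSystem_multiplierOf hA fun k => ?_⟩
  have e1 : w'.2 - R.pieceGrad k.1 (linPoint c w.1 w'.1) = activeLin k₀ l +
      (R.pieceGrad k₀.1 (linPoint c w.1 w'.1) - R.pieceGrad k.1 (linPoint c w.1 w'.1)) := by
    conv_lhs => rw [hs.dual]
    abel
  rw [e1]
  exact Submodule.add_mem _ (LinearMap.mem_range_self _ l)
    (pieceGrad_sub_pieceGrad_mem_range k₀ hM k₀ k)

/-- Curvature is needed only along `z`: the induction hypothesis identifies the base points of both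
steps. -/
lemma eq_of_isManifoldStep {k₀ : R.ActivePiece p₀} (hA : Nondegenerate k₀)
    {z z' : ℕ → Vec n × Vec m × R.Multiplier p₀} (h0 : z' 0 = z 0)
    (hCT : ∀ i, CurvatureTransversality c k₀ (z i).1 (z i).2.1)
    (hz : ∀ i, IsManifoldStep c k₀ (z i) (z (i + 1)))
    (hz' : ∀ i, IsManifoldStep c k₀ (z' i) (z' (i + 1))) : z' = z := by
  funext i
  induction i with
  | zero => exact h0
  | succ i ih =>
    have h1 := hz' i
    rw [ih] at h1
    exact h1.unique hA (hCT i) (hz i)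

lemma IsNewtonSequence.isManifoldStep {k₀ : R.ActivePiece p₀}
    {z : ℕ → Vec n × Vec m × R.Multiplier p₀} (hz : IsNewtonSequence c k₀ z) {i : ℕ}
    (hM : linPoint c (z i).1 (z (i + 1)).1 ∈ R.activeManifold p₀) :
    IsManifoldStep c k₀ (z i) (z (i + 1)) :=
  ⟨(hz.optimality i).stationary, hM, hz.multipliers i⟩

/-- The local behavior of the Newton step: on a small ball the step exists, contracts
quadratically, and has linearized points and multipliers close to the reference ones. -/
lemma exists_radius (hc : ContDiff ℝ 3 c) {xbar : Vec n} {ybar : Vec m}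
    {k₀ : R.ActivePiece (c xbar)} (hA : Nondegenerate k₀)
    (hCT : CurvatureTransversality c k₀ xbar ybar) (hcrit : jacT c xbar ybar = 0)
    {μbar : R.Multiplier (c xbar)} (hμbar : MultiplierSystem k₀ (c xbar) ybar μbar)
    (hpos : ∀ k j, 0 < μbar k j) {V : Set (Vec m)} (hV : V ∈ 𝓝 (c xbar)) :
    ∃ γ : ℝ, 0 < γ ∧ ∃ δ : ℝ, 0 < δ ∧ γ * δ ≤ 1 / 2 ∧
      (∀ w ∈ Metric.ball (xbar, ybar) δ, CurvatureTransversality c k₀ w.1 w.2 ∧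
        ∀ w' l, IsActiveStep c k₀ w w' l →
          ‖w' - (xbar, ybar)‖ ≤ γ * ‖w - (xbar, ybar)‖ ^ 2) ∧
      ∀ w ∈ Metric.ball (xbar, ybar) δ, ∀ w' ∈ Metric.ball (xbar, ybar) δ,
        linPoint c w.1 w'.1 ∈ V ∧ ∀ k j, 0 < multiplierOf k₀ (linPoint c w.1 w'.1) w'.2 k j := by
  obtain ⟨γ, hγ, h1⟩ := eventually_isActiveStep_norm_le hc hA hCT hcrit
    (multiplierSystem_iff.1 hμbar k₀)
  have h2 := eventually_curvatureTransversality hc hA (w₀ := (xbar, ybar)) hCT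
  have hlin : Continuous fun z : (Vec n × Vec m) × (Vec n × Vec m) => linPoint c z.1.1 z.2.1 :=
    continuous_linPoint hc (by fun_prop) (by fun_prop)
  have hlin0 : linPoint c xbar xbar = c xbar := by simp [linPoint]
  have h3 : ∀ᶠ z in 𝓝 ((xbar, ybar), (xbar, ybar)), linPoint c z.1.1 z.2.1 ∈ V :=
    hlin.continuousAt (by simpa [hlin0] using hV)
  have hmul : Continuous fun z : (Vec n × Vec m) × (Vec n × Vec m) =>
      multiplierOf k₀ (linPoint c z.1.1 z.2.1) z.2.2 :=
    continuous_multiplierOf k₀ hlin (by fun_prop)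
  have h4 : ∀ᶠ z in 𝓝 ((xbar, ybar), (xbar, ybar)),
      multiplierOf k₀ (linPoint c z.1.1 z.2.1) z.2.2 ∈
        {μ : R.Multiplier (c xbar) | ∀ k j, 0 < μ k j} := by
    refine hmul.continuousAt (isOpen_pos_multiplier.mem_nhds ?_)
    simp only [hlin0]
    rw [eq_multiplierOf hA hμbar]
    exact hpos
  have h5 := h3.and h4
  -- One neighborhood serves for both the current and the next iterate.
  rw [nhds_prod_eq, eventually_prod_self_iff'] at h5
  obtain ⟨t, ht, h5⟩ := h5
  obtain ⟨ε, hε, hball⟩ := Metric.mem_nhds_iff.1 (Filter.inter_mem ht (h2.and h1))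
  refine ⟨γ, hγ, min ε (1 / 2 / γ), by positivity, ?_, fun w hw => ?_, fun w hw w' hw' => ?_⟩
  · calc γ * min ε (1 / 2 / γ) ≤ γ * (1 / 2 / γ) := by gcongr; exact min_le_right _ _
      _ = 1 / 2 := by field_simp
  · exact (hball (Metric.ball_subset_ball (min_le_left _ _) hw)).2
  · exact h5 w (hball (Metric.ball_subset_ball (min_le_left _ _) hw)).1 w'
      (hball (Metric.ball_subset_ball (min_le_left _ _) hw')).1

/-- The neighborhoods of `(xbar, ybar, μbar)` used for the local convergence theory. -/
def newtonNhd (xbar : Vec n) (ybar : Vec m) (δ : ℝ) : Set (Vec n × Vec m × R.Multiplier p₀) :=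
  {u | (u.1, u.2.1) ∈ Metric.ball (xbar, ybar) δ ∧ ∀ k j, 0 < u.2.2 k j}

lemma newtonNhd_mem_nhds {xbar : Vec n} {ybar : Vec m} {δ : ℝ} (hδ : 0 < δ)
    {μbar : R.Multiplier p₀} (hpos : ∀ k j, 0 < μbar k j) :
    newtonNhd xbar ybar δ ∈ 𝓝 (xbar, ybar, μbar) := by
  have h1 : Continuous fun u : Vec n × Vec m × R.Multiplier p₀ => (u.1, u.2.1) := by
    fun_prop
  have h2 : Continuous fun u : Vec n × Vec m × R.Multiplier p₀ => u.2.2 := by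
    fun_prop
  have h3 : μbar ∈ {μ : R.Multiplier p₀ | ∀ k j, 0 < μ k j} := hpos
  exact Filter.inter_mem
    ((h1.tendsto (xbar, ybar, μbar)).eventually_mem (Metric.ball_mem_nhds _ hδ))
    ((h2.tendsto (xbar, ybar, μbar)).eventually_mem (isOpen_pos_multiplier.mem_nhds h3))

lemma tendsto_of_quadratic_contraction {E : Type*} [NormedAddCommGroup E] {a : E} {z : ℕ → E}
    {γ δ : ℝ} (hγ : 0 < γ) (hγδ : γ * δ ≤ 1 / 2) (hz : ∀ i, ‖z i - a‖ < δ)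
    (hq : ∀ i, ‖z (i + 1) - a‖ ≤ γ * ‖z i - a‖ ^ 2) : Tendsto z atTop (𝓝 a) := by
  have h1 : ∀ i, ‖z i - a‖ ≤ (1 / 2) ^ i * δ := fun i => by
    induction i with
    | zero => simpa using (hz 0).le
    | succ i ih =>
      calc ‖z (i + 1) - a‖ ≤ γ * ‖z i - a‖ ^ 2 := hq i
        _ = γ * ‖z i - a‖ * ‖z i - a‖ := by ring
        _ ≤ γ * δ * ((1 / 2) ^ i * δ) := by
          have := (norm_nonneg _).trans (hz i).le
          have := (hz i).le
          gcongr
        _ ≤ 1 / 2 * ((1 / 2) ^ i * δ) := by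
          have := (norm_nonneg _).trans (hz i).le
          gcongr
        _ = (1 / 2) ^ (i + 1) * δ := by ring
  rw [tendsto_iff_norm_sub_tendsto_zero]
  refine squeeze_zero (fun i => norm_nonneg _) h1 ?_
  simpa using (tendsto_pow_atTop_nhds_zero_of_lt_one (r := (1 / 2 : ℝ)) (by norm_num)
    (by norm_num)).mul_const δ

end Iteration

end

end PLQComposite

/-! ### Assembly of the local convergence theorem. -/

theorem mainTheorem2 {n m : ℕ} (h : Vec m → EReal) (hconv : IsProperConvex h)
    (R : RWRepresentation h) (c : Vec n → Vec m) (hc : ContDiff ℝ 3 c)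
    (xbar : Vec n) (ybar : Vec m)
    (hcard : 2 ≤ Nat.card (R.ActivePiece (c xbar)))
    (k₀ : R.ActivePiece (c xbar))
    (hnondeg : RWRepresentation.Nondegenerate k₀)
    (hSC : StrictlyCritical h c xbar ybar)
    (μbar : R.Multiplier (c xbar))
    (hμbar : RWRepresentation.MultiplierSystem k₀ (c xbar) ybar μbar)
    (hμbar_pos : ∀ k j, 0 < μbar k j)
    (hSOSC : SecondOrderSufficient c k₀ xbar ybar) :
    ∃ N ∈ 𝓝 (xbar, ybar, μbar), ∃ γ : ℝ, 0 < γ ∧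
      (∀ u ∈ N, CurvatureTransversality c k₀ u.1 u.2.1) ∧
      ∀ u ∈ N, ∃ z : ℕ → Vec n × Vec m × R.Multiplier (c xbar),
        z 0 = u ∧ IsNewtonSequence c k₀ z ∧ (∀ i, z i ∈ N) ∧
        -- properties of the iterates
        (∀ i,
          linPoint c (z i).1 (z (i + 1)).1 ∈ R.activeManifold (c xbar) ∧
          (c xbar ∈ intrinsicInterior ℝ (R.activeIntersection (c xbar)) →
            linPoint c (z i).1 (z (i + 1)).1 ∈
              intrinsicInterior ℝ (R.activeIntersection (c xbar))) ∧
          (∀ k, RWRepresentation.multiplierOf k₀ (linPoint c (z i).1 (z (i + 1)).1)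
              (z (i + 1)).2.1 k = (z (i + 1)).2.2 k ∧
            ∀ j, 0 < RWRepresentation.multiplierOf k₀ (linPoint c (z i).1 (z (i + 1)).1)
              (z (i + 1)).2.1 k j) ∧
          (z (i + 1)).2.1 ∈
            intrinsicInterior ℝ (subdifferential h (linPoint c (z i).1 (z (i + 1)).1)) ∧
          hessYC c (z i).2.1 (z i).1 ((z (i + 1)).1 - (z i).1) +
            jacT c (z i).1 (z (i + 1)).2.1 = 0 ∧
          IsStrongLocalMin (modelFn h c (z i).1 (z i).2.1) ((z (i + 1)).1 - (z i).1)) ∧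
        -- quadratic convergence of the primal-dual pairs
        Tendsto (fun i => ((z i).1, (z i).2.1)) atTop (𝓝 (xbar, ybar)) ∧
        (∀ i, ‖((z (i + 1)).1 - xbar, (z (i + 1)).2.1 - ybar)‖ ≤
          γ * ‖((z i).1 - xbar, (z i).2.1 - ybar)‖ ^ 2) ∧
        -- uniqueness among the Newton sequences whose linearized points lie in the manifold
        (∀ z' : ℕ → Vec n × Vec m × R.Multiplier (c xbar), z' 0 = u → IsNewtonSequence c k₀ z' →
          (∀ i, linPoint c (z' i).1 (z' (i + 1)).1 ∈ R.activeManifold (c xbar)) → z' = z) ∧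
        -- uniqueness among the Newton sequences that stay in the neighborhood
        (∀ z' : ℕ → Vec n × Vec m × R.Multiplier (c xbar), z' 0 = u → IsNewtonSequence c k₀ z' →
          (∀ i, z' i ∈ N) → z' = z) := by
  have hCT := curvatureTransversality_of_secondOrderSufficient hconv hnondeg hSC hμbar hμbar_pos
    hSOSC
  have hcrit := hSC.jacT_eq_zero
  obtain ⟨U, hU⟩ := RWRepresentation.exists_isAdapted R (c xbar)
  have hri : ∀ᶠ p in 𝓝 (c xbar), c xbar ∈ intrinsicInterior ℝ (R.activeIntersection (c xbar)) →
      p ∈ R.activeIntersection (c xbar) →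
      p ∈ intrinsicInterior ℝ (R.activeIntersection (c xbar)) := by
    by_cases hm : c xbar ∈ intrinsicInterior ℝ (R.activeIntersection (c xbar))
    · filter_upwards [eventually_mem_intrinsicInterior hm] with p hp _ using hp
    · exact Eventually.of_forall fun p hp => absurd hp hm
  obtain ⟨γ, hγ, δ, hδ, hγδ, hball, hpair⟩ := exists_radius hc hnondeg hCT hcrit hμbar hμbar_pos
    (Filter.inter_mem (hU.isOpen.mem_nhds hU.mem) hri)
  -- Only positivity is required of the multipliers, since the next step depends on the pair `(x,
  -- y)` alone.
  let N : Set (Vec n × Vec m × R.Multiplier (c xbar)) := newtonNhd xbar ybar δ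
  have hN : N ∈ 𝓝 (xbar, ybar, μbar) := newtonNhd_mem_nhds hδ hμbar_pos
  have hstep : ∀ u ∈ N, ∃ u' ∈ N, IsManifoldStep c k₀ u u' := by
    intro u hu
    obtain ⟨h1, h2⟩ := hball _ hu.1
    obtain ⟨w', l, hw'⟩ := exists_isActiveStep (newtonOp_injective hnondeg h1)
    have h3 := h2 w' l hw'
    have h4 : ‖(u.1, u.2.1) - (xbar, ybar)‖ < δ := mem_ball_iff_norm.1 hu.1
    have h5 : w' ∈ Metric.ball (xbar, ybar) δ := by
      rw [mem_ball_iff_norm]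
      have h6 := norm_nonneg ((u.1, u.2.1) - (xbar, ybar))
      -- The new error is at most `γ δ ≤ 1/2` times the old one.
      nlinarith
    obtain ⟨h6, h7⟩ := hpair _ hu.1 w' h5
    exact ⟨(w'.1, w'.2, RWRepresentation.multiplierOf k₀ (linPoint c u.1 w'.1) w'.2), ⟨h5, h7⟩,
      hw'.isManifoldStep (μ := u.2.2) hnondeg hU h6.1⟩
  have hprop : ∀ u ∈ N, ∀ u' ∈ N, IsManifoldStep c k₀ u u' →
      u'.2.1 ∈ intrinsicInterior ℝ (subdifferential h (linPoint c u.1 u'.1)) :=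
    fun u hu u' hu' hs => RWRepresentation.mem_intrinsicInterior_subdifferential hconv hU hnondeg
      (hpair _ hu.1 _ hu'.1).1.1 hs.mem_manifold hs.multipliers hu'.2
  refine ⟨N, hN, γ, hγ, fun u hu => (hball _ hu.1).1, fun u hu => ?_⟩
  choose! next hnext hnextStep using hstep
  let z : ℕ → Vec n × Vec m × R.Multiplier (c xbar) := fun i => next^[i] u
  have hzN : ∀ i, z i ∈ N := fun i => by
    induction i with
    | zero => exact hu
    | succ i ih =>
      simp only [z, Function.iterate_succ_apply']
      exact hnext _ ih
  have hz : ∀ i, IsManifoldStep c k₀ (z i) (z (i + 1)) := fun i => by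
    have h1 := hnextStep (z i) (hzN i)
    rwa [show next (z i) = z (i + 1) from (Function.iterate_succ_apply' next i u).symm] at h1
  have hquad : ∀ i, ‖((z (i + 1)).1 - xbar, (z (i + 1)).2.1 - ybar)‖ ≤
      γ * ‖((z i).1 - xbar, (z i).2.1 - ybar)‖ ^ 2 := fun i => by
    have h1 := (hball _ (hzN i).1).2 _ _ (hz i).isActiveStep
    rwa [Prod.mk_sub_mk, Prod.mk_sub_mk] at h1
  have hCTz : ∀ i, CurvatureTransversality c k₀ (z i).1 (z i).2.1 := fun i =>
    (hball _ (hzN i).1).1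
  refine ⟨z, rfl, ⟨fun i => ⟨(hz i).stationary, ?_⟩, fun i => (hz i).multipliers,
    fun i k j => ((hzN (i + 1)).2 k j).le⟩, hzN, fun i => ?_, ?_, hquad, ?_, ?_⟩
  · exact intrinsicInterior_subset (hprop _ (hzN i) _ (hzN (i + 1)) (hz i))
  · have h1 := (hpair _ (hzN i).1 _ (hzN (i + 1)).1).1
    have h2 := RWRepresentation.eq_multiplierOf hnondeg (hz i).multipliers
    refine ⟨(hz i).mem_manifold, fun hm => h1.2 hm (mem_iInter.2 fun k =>
      RWRepresentation.mem_piece_of_mem_activeManifold (hz i).mem_manifold k), ?_,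
      hprop _ (hzN i) _ (hzN (i + 1)) (hz i), (hz i).stationary, ?_⟩
    · rw [h2]
      exact fun k => ⟨rfl, (hzN (i + 1)).2 k⟩
    · exact isStrongLocalMin_modelFn hc hU (hCTz i) h1.1 (hz i).mem_manifold (hz i).multipliers
        (hzN (i + 1)).2 (hz i).stationary
  · exact tendsto_of_quadratic_contraction hγ hγδ
      (fun i => mem_ball_iff_norm.1 (hzN i).1) hquad
  · intro z' h0 hz' hM
    exact eq_of_isManifoldStep hnondeg h0 hCTz hz fun i => hz'.isManifoldStep (hM i)
  · intro z' h0 hz' hzN'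
    refine eq_of_isManifoldStep hnondeg h0 hCTz hz fun i => hz'.isManifoldStep ?_
    exact RWRepresentation.mem_activeManifold_of_pos_multiplier hU
      (hpair _ (hzN' i).1 _ (hzN' (i + 1)).1).1.1 (hz'.optimality i).subgradient
      (hz'.multipliers i) (hzN' (i + 1)).2
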